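/- Let $K\ge 2$ and consider best-arm identification with $K$ arms whose reward distributions belong to a canonical one-parameter exponential family $P_\eta(dy)\propto e^{\eta y}\rho(dy)$, with natural parameters in the interior of the natural parameter space, parameterized by their means. Let $\theta_1,\dots,\theta_K$ be the mean rewards, let $I^*$ be the unique best arm ($\theta_x<\theta_{I^*}$ for all $x\ne I^*$), let $\mathcal X=[K]\setminus\{I^*\}$, and let $\mathrm{KL}(a\Vert c)$ be the Kullback--Leibler divergence between the members with means $a$ and $c$. For $\bm p\in\mathbb R^K_{\ge0}$ and $\bm\mu\in\mathbb R^{\mathcal X}$ put $$D(\bm p,x)=\inf_{\lambda\in[\theta_x,\theta_{I^*}]}\bigl\{p_{I^*}\mathrm{KL}(\theta_{I^*}\Vert\lambda)+p_x\mathrm{KL}(\theta_x\Vert\lambda)\bigr\},\qquad F(\bm p,\bm\mu)=\sum_{x\in\mathcal X}\mu_xD(\bm p,x).$$ Let $\Delta_K$ and $\Delta_{\mathcal X}$ be the probability simplices, let $\mathcal D_F\subseteq\Delta_K\times\Delta_{\mathcal X}$ be the set of points at which $F$ is differentiable (as a function on $\mathbb R^K_{\ge0}\times\mathbb R^{\mathcal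 X}$), and let $$\partial^\circ_{\bm p}F(\bm p,\bm\mu)=\operatorname{conv}\bigl\{\lim_n\nabla_{\bm p}F(\bm p^n,\bm\mu^n):(\bm p^n,\bm\mu^n)\in\mathcal D_F,\ (\bm p^n,\bm\mu^n)\to(\bm p,\bm\mu)\bigr\}$$ be the Clarke generalized gradient. Define $$\mathrm{LMO}_{\bm p}(\bm p,\bm\mu)=\operatorname{conv}\bigl\{\bm q\in\Delta_K:\exists\,\bm f\in\partial^\circ_{\bm p}F(\bm p,\bm\mu),\ \bm q\in\operatorname{argmax}_{\bm q'\in\Delta_K}\bm q'^\top\bm f\bigr\},\qquad \mathrm{LMO}_{\bm\mu}(\bm p,\bm\mu)=\operatorname{argmin}_{\bm\nu\in\Delta_{\mathcal X}}\bm\nu^\top\nabla_{\bm\mu}F(\bm p,\bm\mu).$$ A solution is a pair $(\bm p,\bm\mu)$ of functions on $[0,\infty)$, absolutely continuous on compact intervals, with arbitrary $(\bm p(0),\bm\mu(0))\in\Delta_K\times\Delta_{\mathcal X}$ (boundary points included) and, for almost every $t\ge0$, $$\dot{\bm p}(t)\in\mathrm{LMO}_{\bm p}(\bm p(t),\bm\mu(t))-\bm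 p(t),\qquad \dot{\bm\mu}(t)\in\mathrm{LMO}_{\bm\mu}(\bm p(t),\bm\mu(t))-\bm\mu(t).$$ (1) There is a finite $M_p$ such that $\|\nabla_{\bm p}D(\bm p,x)\|_\infty\le M_p$ for all $x\in\mathcal X$ and all $\bm p\in\Delta_K$ at which $D(\cdot,x)$ is differentiable. For every such $M_p$ let $$\kappa_{\min}=\min_{x\in\mathcal X}\ \inf_{\lambda\in[\theta_x,\theta_{I^*}]}\max\{\mathrm{KL}(\theta_x\Vert\lambda),\mathrm{KL}(\theta_{I^*}\Vert\lambda)\},\quad \varepsilon_0=\min\Bigl\{\tfrac12,\frac{\kappa_{\min}}{4KM_p}\Bigr\},\quad T^*=(K-1)\bigl(\log(1/\varepsilon_0)+\log2\bigr).$$ Then for every solution and every $t>T^*$, $\bm p(t)$ lies in the relative interior of $\Delta_K$, and $F$ is differentiable at $(\bm p(t),\bm\mu(t))$. (2) The game value converges uniformly over all solutions: there is a Nash equilibrium $(\bm p^*,\bm\mu^*)$ of the zero-sum game with payoff $F$ on $\Delta_K\times\Delta_{\mathcal X}$ ($\bm p$ maximizes, $\bm\mu$ minimizes) such that, with $F^*=F(\bm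 p^*,\bm\mu^*)$, for every $\varepsilon>0$ there is $T$ with $|F(\bm p(t),\bm\mu(t))-F^*|\le\varepsilon$ for every solution and every $t\ge T$. -/

import Mathlib

noncomputable section

namespace FWSP

open MeasureTheory Filter Topology Set ProbabilityTheory

/-! ### Concave-convex games on a product of simplices and their Frank-Wolfe dynamics -/

section Game

variable {ι κ : Type} [Fintype ι] [DecidableEq ι] [Fintype κ] [DecidableEq κ]

/-- The nonnegative orthant. -/
def orthant (ι : Type) : Set (ι → ℝ) := {p | ∀ i, 0 ≤ p i}

/-- The points of the product of the two simplices at which the payoff `F`, as a function on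
its domain (nonnegative orthant in `p`, whole space in `μ`), is differentiable. -/
def diffSet (F : (ι → ℝ) × (κ → ℝ) → ℝ) : Set ((ι → ℝ) × (κ → ℝ)) :=
  {z | z.1 ∈ stdSimplex ℝ ι ∧ z.2 ∈ stdSimplex ℝ κ ∧
    DifferentiableWithinAt ℝ F (orthant ι ×ˢ univ) z}

/-- The gradient of `F` in the first variable. -/
def gradP (F : (ι → ℝ) × (κ → ℝ) → ℝ) (z : (ι → ℝ) × (κ → ℝ)) : ι → ℝ :=
  fun i => fderivWithin ℝ F (orthant ι ×ˢ univ) z (Pi.single i 1, 0)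

/-- The gradient of `F` in the second variable. -/
def gradMu (F : (ι → ℝ) × (κ → ℝ) → ℝ) (z : (ι → ℝ) × (κ → ℝ)) : κ → ℝ :=
  fun x => fderiv ℝ (fun μ => F (z.1, μ)) z.2 (Pi.single x 1)

/-- The Clarke generalized gradient in the first variable: the convex hull of all limits of
gradients along sequences of differentiability points converging to `z`. -/
def clarkeP (F : (ι → ℝ) × (κ → ℝ) → ℝ) (z : (ι → ℝ) × (κ → ℝ)) : Set (ι → ℝ) :=
  convexHull ℝ {f | ∃ u : ℕ → (ι → ℝ) × (κ → ℝ), (∀ n, u n ∈ diffSet F) ∧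
    Tendsto u atTop (𝓝 z) ∧ Tendsto (fun n => gradP F (u n)) atTop (𝓝 f)}

/-- Linear maximization oracle of the first player. -/
def LMOp (F : (ι → ℝ) × (κ → ℝ) → ℝ) (z : (ι → ℝ) × (κ → ℝ)) : Set (ι → ℝ) :=
  convexHull ℝ {q | q ∈ stdSimplex ℝ ι ∧
    ∃ f ∈ clarkeP F z, ∀ q' ∈ stdSimplex ℝ ι, q' ⬝ᵥ f ≤ q ⬝ᵥ f}

/-- Linear minimization oracle of the second player. -/
def LMOmu (F : (ι → ℝ) × (κ → ℝ) → ℝ) (z : (ι → ℝ) × (κ → ℝ)) : Set (κ → ℝ) :=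
  {ν | ν ∈ stdSimplex ℝ κ ∧ ∀ ν' ∈ stdSimplex ℝ κ, ν ⬝ᵥ gradMu F z ≤ ν' ⬝ᵥ gradMu F z}

/-- `(p, μ)` is a solution on `[0, ∞)` of the differential inclusion
`p' ∈ LMOp (p, μ) - p`, `μ' ∈ LMOmu (p, μ) - μ` with some initial condition in the product of
the closed simplices: it is absolutely continuous on compact intervals and satisfies the
inclusion at almost every time. -/
structure IsSolution (F : (ι → ℝ) × (κ → ℝ) → ℝ) (p : ℝ → ι → ℝ) (μ : ℝ → κ → ℝ) : Prop where
  ac_p : ∀ T : ℝ, 0 ≤ T → AbsolutelyContinuousOnInterval p 0 T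
  ac_mu : ∀ T : ℝ, 0 ≤ T → AbsolutelyContinuousOnInterval μ 0 T
  init_p : p 0 ∈ stdSimplex ℝ ι
  init_mu : μ 0 ∈ stdSimplex ℝ κ
  deriv_p : ∀ᵐ t ∂(volume.restrict (Ici (0 : ℝ))),
    ∃ q ∈ LMOp F (p t, μ t), HasDerivAt p (q - p t) t
  deriv_mu : ∀ᵐ t ∂(volume.restrict (Ici (0 : ℝ))),
    ∃ ν ∈ LMOmu F (p t, μ t), HasDerivAt μ (ν - μ t) t

/-- Nash equilibrium of the zero-sum game in which `p` maximizes and `μ` minimizes `F`. -/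
def IsNash (F : (ι → ℝ) × (κ → ℝ) → ℝ) (ps : ι → ℝ) (μs : κ → ℝ) : Prop :=
  ps ∈ stdSimplex ℝ ι ∧ μs ∈ stdSimplex ℝ κ ∧
    (∀ p ∈ stdSimplex ℝ ι, F (p, μs) ≤ F (ps, μs)) ∧
    (∀ μ ∈ stdSimplex ℝ κ, F (ps, μs) ≤ F (ps, μ))

end Game

/-! ### Canonical one-parameter exponential families, parameterized by the mean -/

/-- The interior of the natural parameter space `{η | ∫ exp (η y) ρ(dy) < ∞}` of the
exponential family generated by `ρ`. -/
def natSpace (ρ : Measure ℝ) : Set ℝ := interior (integrableExpSet id ρ)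

/-- The member `exp (η y) ρ(dy) / ∫ exp (η y) ρ(dy)` with natural parameter `η`. -/
def natMember (ρ : Measure ℝ) (η : ℝ) : Measure ℝ := ρ.tilted (fun y => η * y)

/-- The mean of the member with natural parameter `η`. -/
def meanOf (ρ : Measure ℝ) (η : ℝ) : ℝ := ∫ y, y ∂(natMember ρ η)

/-- The mean parameter space. -/
def meanSpace (ρ : Measure ℝ) : Set ℝ := meanOf ρ '' natSpace ρ

/-- The member with mean `m`, for `m` in the mean parameter space. -/
def member (ρ : Measure ℝ) (m : ℝ) : Measure ℝ :=
  natMember ρ (Function.invFunOn (meanOf ρ) (natSpace ρ) m)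

/-- Kullback-Leibler divergence between the members with means `a` and `c`. -/
def KL (ρ : Measure ℝ) (a c : ℝ) : ℝ :=
  (InformationTheory.klDiv (member ρ a) (member ρ c)).toReal

/-! ### Best-arm identification -/

section BAI

variable {K : ℕ}

/-- The scenarios: all arms but the best arm `b`. -/
abbrev Scenario (b : Fin K) : Type := {x : Fin K // x ≠ b}

/-- The payoff in scenario `x`. -/
def D (ρ : Measure ℝ) (θ : Fin K → ℝ) (b : Fin K) (p : Fin K → ℝ) (x : Scenario b) : ℝ :=
  sInf ((fun l => p b * KL ρ (θ b) l + p x * KL ρ (θ x) l) '' Icc (θ x) (θ b))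

/-- The mixed payoff. -/
def payoff (ρ : Measure ℝ) (θ : Fin K → ℝ) (b : Fin K)
    (z : (Fin K → ℝ) × (Scenario b → ℝ)) : ℝ :=
  ∑ x, z.2 x * D ρ θ b z.1 x

/-- `M` bounds the sup-norm of the gradients of all `D(·, x)` at their differentiability points
in the simplex. -/
def IsGradBound (ρ : Measure ℝ) (θ : Fin K → ℝ) (b : Fin K) (M : ℝ) : Prop :=
  ∀ x : Scenario b, ∀ p ∈ stdSimplex ℝ (Fin K),
    DifferentiableWithinAt ℝ (fun p' => D ρ θ b p' x) (orthant (Fin K)) p →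
    ∀ i, |fderivWithin ℝ (fun p' => D ρ θ b p' x) (orthant (Fin K)) p (Pi.single i 1)| ≤ M

/-- The constant `κ_x`. -/
def kappa (ρ : Measure ℝ) (θ : Fin K → ℝ) (b : Fin K) (x : Scenario b) : ℝ :=
  sInf ((fun l => max (KL ρ (θ x) l) (KL ρ (θ b) l)) '' Icc (θ x) (θ b))

/-- The constant `κ_min`, the minimum of the `κ_x`. -/
def kappaMin (ρ : Measure ℝ) (θ : Fin K → ℝ) (b : Fin K) : ℝ :=
  ⨅ x : Scenario b, kappa ρ θ b x

/-- The constant `ε₀`, for the gradient bound `M`. -/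
def eps0 (ρ : Measure ℝ) (θ : Fin K → ℝ) (b : Fin K) (M : ℝ) : ℝ :=
  min (1 / 2) (kappaMin ρ θ b / (4 * (K : ℝ) * M))

/-- The entry time `T*`, for the gradient bound `M`. -/
def Tstar (ρ : Measure ℝ) (θ : Fin K → ℝ) (b : Fin K) (M : ℝ) : ℝ :=
  ((K : ℝ) - 1) * (Real.log (1 / eps0 ρ θ b M) + Real.log 2)

end BAI

end FWSP

end

noncomputable section

namespace FWSP

open MeasureTheory Filter Topology Set ProbabilityTheory

/-! ### Divergences in a one-parameter exponential family -/

/-- The natural parameter of the member with mean `m`. -/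
def natOf (ρ : Measure ℝ) (m : ℝ) : ℝ := Function.invFunOn (meanOf ρ) (natSpace ρ) m

/-- The derivative of the natural parameter with respect to the mean. -/
def natOfDeriv (ρ : Measure ℝ) (m : ℝ) : ℝ := (iteratedDeriv 2 (cgf id ρ) (natOf ρ m))⁻¹

section ExpFamily

variable {ρ : Measure ℝ}

lemma isOpen_natSpace : IsOpen (natSpace ρ) := isOpen_interior

lemma convex_natSpace : Convex ℝ (natSpace ρ) := convex_integrableExpSet.interior

lemma integrable_exp_of_mem_natSpace {η : ℝ} (h : η ∈ natSpace ρ) :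
    Integrable (fun y => Real.exp (η * y)) ρ :=
  (interior_subset h : η ∈ integrableExpSet id ρ)

lemma meanOf_eq_deriv_cgf {η : ℝ} (h : η ∈ natSpace ρ) : meanOf ρ η = deriv (cgf id ρ) η :=
  integral_tilted_mul_self h

lemma hasDerivAt_cgf {η : ℝ} (h : η ∈ natSpace ρ) : HasDerivAt (cgf id ρ) (meanOf ρ η) η := by
  rw [meanOf_eq_deriv_cgf h]
  exact (analyticAt_cgf h).differentiableAt.hasDerivAt

lemma meanOf_eventuallyEq {η : ℝ} (h : η ∈ natSpace ρ) :
    meanOf ρ =ᶠ[𝓝 η] deriv (cgf id ρ) := by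
  filter_upwards [isOpen_natSpace.mem_nhds h] with y hy using meanOf_eq_deriv_cgf hy

lemma hasStrictDerivAt_meanOf {η : ℝ} (h : η ∈ natSpace ρ) :
    HasStrictDerivAt (meanOf ρ) (iteratedDeriv 2 (cgf id ρ) η) η := by
  have h1 : AnalyticAt ℝ (deriv (cgf id ρ)) η := (analyticAt_cgf h).deriv
  have h2 : HasStrictDerivAt (deriv (cgf id ρ)) (iteratedDeriv 2 (cgf id ρ) η) η := by
    rw [iteratedDeriv_succ, iteratedDeriv_one]
    exact h1.hasStrictDerivAt
  exact h2.congr_of_eventuallyEq (meanOf_eventuallyEq h).symm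

lemma continuousOn_iteratedDeriv_cgf :
    ContinuousOn (iteratedDeriv 2 (cgf id ρ)) (natSpace ρ) := by
  intro η h
  rw [iteratedDeriv_succ, iteratedDeriv_one]
  exact (analyticAt_cgf h).deriv.deriv.continuousAt.continuousWithinAt

lemma neZero_of_nontrivial_meanSpace (hρ : (meanSpace ρ).Nontrivial) : NeZero ρ := by
  refine ⟨fun h0 => ?_⟩
  obtain ⟨_, ⟨η₁, _, rfl⟩, _, ⟨η₂, _, rfl⟩, hne⟩ := hρ
  simp [meanOf, natMember, h0] at hne

lemma isProbabilityMeasure_natMember [NeZero ρ] {η : ℝ} (h : η ∈ natSpace ρ) :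
    IsProbabilityMeasure (natMember ρ η) :=
  isProbabilityMeasure_tilted (integrable_exp_of_mem_natSpace h)

lemma iteratedDeriv_cgf_pos (hρ : (meanSpace ρ).Nontrivial) {η : ℝ} (h : η ∈ natSpace ρ) :
    0 < iteratedDeriv 2 (cgf id ρ) η := by
  have := neZero_of_nontrivial_meanSpace hρ
  have hvar : Var[id; natMember ρ η] = iteratedDeriv 2 (cgf id ρ) η := variance_tilted_mul h
  have := isProbabilityMeasure_natMember h
  rw [← hvar]
  refine lt_of_le_of_ne (variance_nonneg _ _) fun h0 => ?_
  have hmem : MemLp id 2 (natMember ρ η) := memLp_tilted_mul (X := id) h 2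
  have hae : ∀ᵐ y ∂ρ, y = (natMember ρ η)[id] := by
    have := ae_eq_integral_of_variance_eq_zero hmem h0.symm
    exact (absolutelyContinuous_tilted (integrable_exp_of_mem_natSpace h)).ae_le this
  have key : ∀ η' ∈ natSpace ρ, meanOf ρ η' = (natMember ρ η)[id] := by
    intro η' h'
    have := isProbabilityMeasure_natMember h'
    have h2 : ∀ᵐ y ∂(natMember ρ η'), y = (natMember ρ η)[id] :=
      (tilted_absolutelyContinuous ρ (fun y => η' * y)).ae_le hae
    rw [meanOf, integral_congr_ae h2]
    simp
  obtain ⟨_, ⟨η₁, h₁, rfl⟩, _, ⟨η₂, h₂, rfl⟩, hne⟩ := hρ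
  exact hne ((key _ h₁).trans (key _ h₂).symm)

lemma strictMonoOn_meanOf (hρ : (meanSpace ρ).Nontrivial) :
    StrictMonoOn (meanOf ρ) (natSpace ρ) := by
  refine strictMonoOn_of_deriv_pos convex_natSpace
    (fun η h => (hasStrictDerivAt_meanOf h).hasDerivAt.continuousAt.continuousWithinAt) ?_
  intro η h
  have h' := interior_subset h
  rw [(hasStrictDerivAt_meanOf h').hasDerivAt.deriv]
  exact iteratedDeriv_cgf_pos hρ h'

lemma natOf_mem {m : ℝ} (h : m ∈ meanSpace ρ) : natOf ρ m ∈ natSpace ρ :=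
  Function.invFunOn_mem h

lemma meanOf_natOf {m : ℝ} (h : m ∈ meanSpace ρ) : meanOf ρ (natOf ρ m) = m :=
  Function.invFunOn_eq h

lemma natOf_meanOf (hρ : (meanSpace ρ).Nontrivial) {η : ℝ} (h : η ∈ natSpace ρ) :
    natOf ρ (meanOf ρ η) = η :=
  (strictMonoOn_meanOf hρ).injOn (natOf_mem ⟨η, h, rfl⟩) h (meanOf_natOf ⟨η, h, rfl⟩)

lemma strictMonoOn_natOf (hρ : (meanSpace ρ).Nontrivial) :
    StrictMonoOn (natOf ρ) (meanSpace ρ) := by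
  intro m hm m' hm' hlt
  rw [← (strictMonoOn_meanOf hρ).lt_iff_lt (natOf_mem hm) (natOf_mem hm'), meanOf_natOf hm,
    meanOf_natOf hm']
  exact hlt

lemma image_natOf (hρ : (meanSpace ρ).Nontrivial) : natOf ρ '' meanSpace ρ = natSpace ρ := by
  ext η
  constructor
  · rintro ⟨m, hm, rfl⟩
    exact natOf_mem hm
  · exact fun h => ⟨meanOf ρ η, ⟨η, h, rfl⟩, natOf_meanOf hρ h⟩

lemma isOpen_meanSpace (hρ : (meanSpace ρ).Nontrivial) : IsOpen (meanSpace ρ) := by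
  rw [isOpen_iff_mem_nhds]
  rintro _ ⟨η, h, rfl⟩
  rw [← (hasStrictDerivAt_meanOf h).map_nhds_eq (iteratedDeriv_cgf_pos hρ h).ne']
  exact image_mem_map (isOpen_natSpace.mem_nhds h)

lemma ordConnected_meanSpace : (meanSpace ρ).OrdConnected := by
  refine IsPreconnected.ordConnected ?_
  refine convex_natSpace.isPreconnected.image _ ?_
  exact fun η h => (hasStrictDerivAt_meanOf h).hasDerivAt.continuousAt.continuousWithinAt

lemma continuousAt_natOf (hρ : (meanSpace ρ).Nontrivial) {m : ℝ} (h : m ∈ meanSpace ρ) :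
    ContinuousAt (natOf ρ) m := by
  refine (strictMonoOn_natOf hρ).continuousAt_of_image_mem_nhds
    ((isOpen_meanSpace hρ).mem_nhds h) ?_
  rw [image_natOf hρ]
  exact isOpen_natSpace.mem_nhds (natOf_mem h)

lemma natOfDeriv_pos (hρ : (meanSpace ρ).Nontrivial) {m : ℝ} (h : m ∈ meanSpace ρ) :
    0 < natOfDeriv ρ m :=
  inv_pos.2 (iteratedDeriv_cgf_pos hρ (natOf_mem h))

lemma continuousOn_natOfDeriv (hρ : (meanSpace ρ).Nontrivial) :
    ContinuousOn (natOfDeriv ρ) (meanSpace ρ) := by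
  refine ContinuousOn.inv₀ ?_ fun m hm => (iteratedDeriv_cgf_pos hρ (natOf_mem hm)).ne'
  exact continuousOn_iteratedDeriv_cgf.comp
    (fun m hm => (continuousAt_natOf hρ hm).continuousWithinAt) fun m hm => natOf_mem hm

lemma hasDerivAt_natOf (hρ : (meanSpace ρ).Nontrivial) {m : ℝ} (h : m ∈ meanSpace ρ) :
    HasDerivAt (natOf ρ) (natOfDeriv ρ m) m := by
  refine HasDerivAt.of_local_left_inverse (continuousAt_natOf hρ h)
    (hasStrictDerivAt_meanOf (natOf_mem h)).hasDerivAt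
    (iteratedDeriv_cgf_pos hρ (natOf_mem h)).ne' ?_
  filter_upwards [(isOpen_meanSpace hρ).mem_nhds h] with y hy using meanOf_natOf hy

lemma toReal_klDiv_natMember [NeZero ρ] {η η' : ℝ} (h : η ∈ natSpace ρ) (h' : η' ∈ natSpace ρ) :
    (InformationTheory.klDiv (natMember ρ η) (natMember ρ η')).toReal
      = (η - η') * meanOf ρ η - cgf id ρ η + cgf id ρ η' := by
  have := isProbabilityMeasure_natMember h
  have := isProbabilityMeasure_natMember h'
  have hint := integrable_exp_of_mem_natSpace h
  have hint' := integrable_exp_of_mem_natSpace h'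
  have htilt : natMember ρ η = (natMember ρ η').tilted (fun y => (η - η') * y) := by
    rw [natMember, natMember, tilted_tilted hint']
    congr 1
    ext y
    simp
    ring
  have hexp : Integrable (fun y => Real.exp ((η - η') * y)) (natMember ρ η') := by
    rw [natMember, integrable_tilted_iff hint']
    refine hint.congr (ae_of_all _ fun y => ?_)
    simp only [smul_eq_mul, ← Real.exp_add]
    ring_nf
  have hac : natMember ρ η ≪ natMember ρ η' := htilt ▸ tilted_absolutelyContinuous _ _
  have hlog := log_rnDeriv_tilted_left_self hexp
  rw [← htilt] at hlog
  have hval : Real.log (∫ y, Real.exp ((η - η') * y) ∂(natMember ρ η'))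
      = cgf id ρ η - cgf id ρ η' := by
    have := integral_exp_tilted (μ := ρ) (fun y => η' * y) (fun y => (η - η') * y)
    rw [natMember, this, Real.log_div]
    · simp only [cgf, mgf, id, Pi.add_apply]
      congr 3
      ext y
      ring_nf
    · refine (integral_exp_pos (hint.congr (ae_of_all _ fun y => ?_))).ne'
      simp only [Pi.add_apply]
      ring_nf
    · exact (integral_exp_pos hint').ne'
  have hid : Integrable (fun y : ℝ => y) (natMember ρ η) := by
    have : MemLp id 1 (natMember ρ η) := memLp_tilted_mul (X := id) h 1
    exact memLp_one_iff_integrable.1 this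
  rw [InformationTheory.toReal_klDiv_of_measure_eq hac (by simp), llr_def]
  rw [integral_congr_ae (hac.ae_le hlog), hval, integral_sub (hid.const_mul _) (by fun_prop),
    integral_const_mul]
  simp [meanOf]
  ring

lemma KL_eq (hρ : (meanSpace ρ).Nontrivial) {a l : ℝ} (ha : a ∈ meanSpace ρ)
    (hl : l ∈ meanSpace ρ) :
    KL ρ a l = (natOf ρ a - natOf ρ l) * a - cgf id ρ (natOf ρ a) + cgf id ρ (natOf ρ l) := by
  have := neZero_of_nontrivial_meanSpace hρ
  have := toReal_klDiv_natMember (natOf_mem ha) (natOf_mem hl)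
  rw [meanOf_natOf ha] at this
  exact this

lemma KL_nonneg (a l : ℝ) : 0 ≤ KL ρ a l := ENNReal.toReal_nonneg

lemma KL_self (hρ : (meanSpace ρ).Nontrivial) {a : ℝ} (ha : a ∈ meanSpace ρ) : KL ρ a a = 0 := by
  rw [KL_eq hρ ha ha]
  ring

lemma hasDerivAt_KL (hρ : (meanSpace ρ).Nontrivial) {a l : ℝ} (ha : a ∈ meanSpace ρ)
    (hl : l ∈ meanSpace ρ) : HasDerivAt (KL ρ a) ((l - a) * natOfDeriv ρ l) l := by
  have h1 := hasDerivAt_natOf hρ hl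
  have h2 : HasDerivAt (fun l => cgf id ρ (natOf ρ l)) (l * natOfDeriv ρ l) l := by
    have := (hasDerivAt_cgf (natOf_mem hl)).comp l h1
    rwa [meanOf_natOf hl] at this
  have h3 := ((((hasDerivAt_const l (natOf ρ a)).sub h1).mul_const a).sub_const
    (cgf id ρ (natOf ρ a))).add h2
  have h4 : (fun l => (natOf ρ a - natOf ρ l) * a - cgf id ρ (natOf ρ a) + cgf id ρ (natOf ρ l))
      =ᶠ[𝓝 l] KL ρ a := by
    filter_upwards [(isOpen_meanSpace hρ).mem_nhds hl] with y hy using (KL_eq hρ ha hy).symm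
  refine (h3.congr_of_eventuallyEq h4.symm).congr_deriv ?_
  ring

lemma continuousOn_KL (hρ : (meanSpace ρ).Nontrivial) {a : ℝ} (ha : a ∈ meanSpace ρ) :
    ContinuousOn (KL ρ a) (meanSpace ρ) :=
  fun _ hl => (hasDerivAt_KL hρ ha hl).continuousAt.continuousWithinAt

lemma lipschitzOnWith_KL (hρ : (meanSpace ρ).Nontrivial) {a c d : ℝ} (ha : a ∈ meanSpace ρ)
    (hc : c ∈ meanSpace ρ) (hd : d ∈ meanSpace ρ) :
    ∃ C, LipschitzOnWith C (KL ρ a) (Icc c d) := by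
  have hsub : Icc c d ⊆ meanSpace ρ := ordConnected_meanSpace.out hc hd
  have hcont : ContinuousOn (fun l => (l - a) * natOfDeriv ρ l) (Icc c d) :=
    (by fun_prop : ContinuousOn (fun l : ℝ => l - a) (Icc c d)).mul
      ((continuousOn_natOfDeriv hρ).mono hsub)
  obtain ⟨C, hC⟩ := isCompact_Icc.exists_bound_of_continuousOn hcont
  refine ⟨C.toNNReal, (convex_Icc c d).lipschitzOnWith_of_nnnorm_hasDerivWithin_le
    (fun l hl => (hasDerivAt_KL hρ ha (hsub hl)).hasDerivWithinAt) fun l hl => ?_⟩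
  rw [← NNReal.coe_le_coe, coe_nnnorm]
  exact (hC l hl).trans (Real.le_coe_toNNReal C)

lemma strictMonoOn_KL (hρ : (meanSpace ρ).Nontrivial) {a d : ℝ} (ha : a ∈ meanSpace ρ)
    (hd : d ∈ meanSpace ρ) : StrictMonoOn (KL ρ a) (Icc a d) := by
  have hsub : Icc a d ⊆ meanSpace ρ := ordConnected_meanSpace.out ha hd
  refine strictMonoOn_of_deriv_pos (convex_Icc a d) ((continuousOn_KL hρ ha).mono hsub) ?_
  intro l hl
  have hl' := hsub (interior_subset hl)
  rw [interior_Icc] at hl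
  rw [(hasDerivAt_KL hρ ha hl').deriv]
  exact mul_pos (sub_pos.2 hl.1) (natOfDeriv_pos hρ hl')

lemma strictAntiOn_KL (hρ : (meanSpace ρ).Nontrivial) {a d : ℝ} (ha : a ∈ meanSpace ρ)
    (hd : d ∈ meanSpace ρ) : StrictAntiOn (KL ρ a) (Icc d a) := by
  have hsub : Icc d a ⊆ meanSpace ρ := ordConnected_meanSpace.out hd ha
  refine strictAntiOn_of_deriv_neg (convex_Icc d a) ((continuousOn_KL hρ ha).mono hsub) ?_
  intro l hl
  have hl' := hsub (interior_subset hl)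
  rw [interior_Icc] at hl
  rw [(hasDerivAt_KL hρ ha hl').deriv]
  exact mul_neg_of_neg_of_pos (sub_neg.2 hl.2) (natOfDeriv_pos hρ hl')

lemma KL_pos (hρ : (meanSpace ρ).Nontrivial) {a l : ℝ} (ha : a ∈ meanSpace ρ)
    (hl : l ∈ meanSpace ρ) (hne : a ≠ l) : 0 < KL ρ a l := by
  rw [← KL_self hρ ha]
  rcases hne.lt_or_gt with h | h
  · exact strictMonoOn_KL hρ ha hl (left_mem_Icc.2 h.le) (right_mem_Icc.2 h.le) h
  · exact strictAntiOn_KL hρ ha hl (left_mem_Icc.2 h.le) (right_mem_Icc.2 h.le) h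

/-- A weighted sum of two divergences is minimal at the weighted mean. -/
lemma weighted_KL_le (hρ : (meanSpace ρ).Nontrivial) {a c u w m l : ℝ} (ha : a ∈ meanSpace ρ)
    (hc : c ∈ meanSpace ρ) (hs : 0 ≤ u + w) (hm : (u + w) * m = u * c + w * a)
    (hma : m ∈ Icc a c) (hl : l ∈ Icc a c) :
    u * KL ρ c m + w * KL ρ a m ≤ u * KL ρ c l + w * KL ρ a l := by
  have hsub : Icc a c ⊆ meanSpace ρ := ordConnected_meanSpace.out ha hc
  have hderiv : ∀ y ∈ Icc a c, HasDerivAt (fun y => u * KL ρ c y + w * KL ρ a y)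
      ((u + w) * (y - m) * natOfDeriv ρ y) y := by
    intro y hy
    refine (((hasDerivAt_KL hρ hc (hsub hy)).const_mul u).add
      ((hasDerivAt_KL hρ ha (hsub hy)).const_mul w)).congr_deriv ?_
    linear_combination natOfDeriv ρ y * hm
  rcases le_total l m with h | h
  · have hsub' : Icc l m ⊆ Icc a c := Icc_subset_Icc hl.1 hma.2
    have hanti : AntitoneOn (fun y => u * KL ρ c y + w * KL ρ a y) (Icc l m) := by
      refine antitoneOn_of_deriv_nonpos (convex_Icc l m)
        (fun y hy => (hderiv y (hsub' hy)).continuousAt.continuousWithinAt)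
        (fun y hy =>
          (hderiv y (hsub' (interior_subset hy))).differentiableAt.differentiableWithinAt)
        fun y hy => ?_
      have hy' := interior_subset hy
      rw [(hderiv y (hsub' hy')).deriv]
      exact mul_nonpos_of_nonpos_of_nonneg
        (mul_nonpos_of_nonneg_of_nonpos hs (sub_nonpos.2 hy'.2))
        (natOfDeriv_pos hρ (hsub (hsub' hy'))).le
    exact hanti (left_mem_Icc.2 h) (right_mem_Icc.2 h) h
  · have hsub' : Icc m l ⊆ Icc a c := Icc_subset_Icc hma.1 hl.2
    have hmono : MonotoneOn (fun y => u * KL ρ c y + w * KL ρ a y) (Icc m l) := by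
      refine monotoneOn_of_deriv_nonneg (convex_Icc m l)
        (fun y hy => (hderiv y (hsub' hy)).continuousAt.continuousWithinAt)
        (fun y hy =>
          (hderiv y (hsub' (interior_subset hy))).differentiableAt.differentiableWithinAt)
        fun y hy => ?_
      have hy' := interior_subset hy
      rw [(hderiv y (hsub' hy')).deriv]
      exact mul_nonneg (mul_nonneg hs (sub_nonneg.2 hy'.1))
        (natOfDeriv_pos hρ (hsub (hsub' hy'))).le
    exact hmono (left_mem_Icc.2 h) (right_mem_Icc.2 h) h

end ExpFamily

/-! ### The scenario payoffs -/

section Payoff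

variable {K : ℕ}

/-- The means lie in the mean space of the family and `b` is the unique best arm among at least
two arms. -/
structure IsBandit (ρ : Measure ℝ) (θ : Fin K → ℝ) (b : Fin K) : Prop where
  two_le : 2 ≤ K
  mem : ∀ i, θ i ∈ meanSpace ρ
  lt : ∀ x : Scenario b, θ x < θ b

/-- The minimizing alternative mean in scenario `x`. -/
def lam (θ : Fin K → ℝ) (b : Fin K) (p : Fin K → ℝ) (x : Scenario b) : ℝ :=
  if p b + p x = 0 then θ b else (p b * θ b + p x * θ x) / (p b + p x)

/-- The gradient of the payoff in the first variable, at points of differentiability. -/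
def gvec (ρ : Measure ℝ) (θ : Fin K → ℝ) (b : Fin K) (p : Fin K → ℝ) (μ : Scenario b → ℝ) :
    Fin K → ℝ :=
  fun i => ∑ x, μ x * ((Pi.single i 1 : Fin K → ℝ) b * KL ρ (θ b) (lam θ b p x)
    + (Pi.single i 1 : Fin K → ℝ) x * KL ρ (θ x) (lam θ b p x))

variable {ρ : Measure ℝ} {θ : Fin K → ℝ} {b : Fin K}

namespace IsBandit

lemma nonempty (h : IsBandit ρ θ b) : Nonempty (Scenario b) := by
  have : Nontrivial (Fin K) := Fin.nontrivial_iff_two_le.2 h.two_le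
  obtain ⟨x, hx⟩ := exists_ne b
  exact ⟨⟨x, hx⟩⟩

lemma nontrivial (h : IsBandit ρ θ b) : (meanSpace ρ).Nontrivial := by
  obtain ⟨x⟩ := h.nonempty
  exact ⟨θ x, h.mem x, θ b, h.mem b, (h.lt x).ne⟩

lemma Icc_subset (h : IsBandit ρ θ b) (x : Scenario b) : Icc (θ x) (θ b) ⊆ meanSpace ρ :=
  ordConnected_meanSpace.out (h.mem x) (h.mem b)

lemma sum_mul_lam {p : Fin K → ℝ} (hp : p ∈ orthant (Fin K)) (x : Scenario b) :
    (p b + p x) * lam θ b p x = p b * θ b + p x * θ x := by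
  unfold lam
  split_ifs with h0
  · have h1 := hp b
    have h2 := hp x
    have h3 : p b = 0 := by linarith
    have h4 : p x = 0 := by linarith
    rw [h3, h4]
    ring
  · field_simp

lemma lam_mem (h : IsBandit ρ θ b) {p : Fin K → ℝ} (hp : p ∈ orthant (Fin K)) (x : Scenario b) :
    lam θ b p x ∈ Icc (θ x) (θ b) := by
  have h1 := hp b
  have h2 := hp x
  have h3 := h.lt x
  unfold lam
  split_ifs with h0
  · exact right_mem_Icc.2 h3.le
  · have h5 : 0 < p b + p x := lt_of_le_of_ne (by linarith) (Ne.symm h0)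
    constructor
    · rw [le_div_iff₀ h5]
      nlinarith
    · rw [div_le_iff₀ h5]
      nlinarith

lemma lam_mem_meanSpace (h : IsBandit ρ θ b) {p : Fin K → ℝ} (hp : p ∈ orthant (Fin K))
    (x : Scenario b) : lam θ b p x ∈ meanSpace ρ := h.Icc_subset x (h.lam_mem hp x)

lemma lam_of_eq_zero_left {p : Fin K → ℝ} {x : Scenario b} (hpb : p b = 0) (hpx : p x ≠ 0) :
    lam θ b p x = θ x := by
  simp only [lam, hpb, zero_add, hpx, if_false, zero_mul]
  field_simp

lemma lam_of_eq_zero_right {p : Fin K → ℝ} {x : Scenario b} (hpx : p x = 0) :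
    lam θ b p x = θ b := by
  unfold lam
  split_ifs with h0
  · rfl
  · rw [hpx] at h0 ⊢
    simp only [add_zero, zero_mul] at h0 ⊢
    field_simp

lemma isLeast_D (h : IsBandit ρ θ b) {p : Fin K → ℝ} (hp : p ∈ orthant (Fin K))
    (x : Scenario b) :
    IsLeast ((fun l => p b * KL ρ (θ b) l + p x * KL ρ (θ x) l) '' Icc (θ x) (θ b))
      (p b * KL ρ (θ b) (lam θ b p x) + p x * KL ρ (θ x) (lam θ b p x)) := by
  refine ⟨⟨_, h.lam_mem hp x, rfl⟩, ?_⟩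
  rintro _ ⟨l, hl, rfl⟩
  exact weighted_KL_le h.nontrivial (h.mem x) (h.mem b) (add_nonneg (hp b) (hp x))
    (sum_mul_lam hp x) (h.lam_mem hp x) hl

lemma D_eq (h : IsBandit ρ θ b) {p : Fin K → ℝ} (hp : p ∈ orthant (Fin K)) (x : Scenario b) :
    D ρ θ b p x = p b * KL ρ (θ b) (lam θ b p x) + p x * KL ρ (θ x) (lam θ b p x) :=
  (h.isLeast_D hp x).csInf_eq

lemma D_le (h : IsBandit ρ θ b) {p : Fin K → ℝ} (hp : p ∈ orthant (Fin K)) (x : Scenario b)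
    {l : ℝ} (hl : l ∈ Icc (θ x) (θ b)) :
    D ρ θ b p x ≤ p b * KL ρ (θ b) l + p x * KL ρ (θ x) l := by
  rw [h.D_eq hp x]
  exact (h.isLeast_D hp x).2 ⟨l, hl, rfl⟩

lemma D_nonneg (h : IsBandit ρ θ b) {p : Fin K → ℝ} (hp : p ∈ orthant (Fin K))
    (x : Scenario b) : 0 ≤ D ρ θ b p x := by
  rw [h.D_eq hp x]
  exact add_nonneg (mul_nonneg (hp b) (KL_nonneg _ _)) (mul_nonneg (hp x) (KL_nonneg _ _))

lemma max_KL_pos (h : IsBandit ρ θ b) (x : Scenario b) {l : ℝ} (hl : l ∈ Icc (θ x) (θ b)) :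
    0 < max (KL ρ (θ x) l) (KL ρ (θ b) l) := by
  have hl' := h.Icc_subset x hl
  rcases eq_or_ne (θ x) l with h1 | h1
  · exact lt_max_of_lt_right (KL_pos h.nontrivial (h.mem b) hl' (by rw [← h1]; exact (h.lt x).ne'))
  · exact lt_max_of_lt_left (KL_pos h.nontrivial (h.mem x) hl' h1)

lemma D_pos (h : IsBandit ρ θ b) {p : Fin K → ℝ} (hp : p ∈ orthant (Fin K)) (x : Scenario b)
    (hpb : 0 < p b) (hpx : 0 < p x) : 0 < D ρ θ b p x := by
  rw [h.D_eq hp x]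
  have h1 : 0 ≤ KL ρ (θ b) (lam θ b p x) := KL_nonneg _ _
  have h2 : 0 ≤ KL ρ (θ x) (lam θ b p x) := KL_nonneg _ _
  rcases lt_max_iff.1 (h.max_KL_pos x (h.lam_mem hp x)) with h3 | h3 <;> positivity

lemma D_of_eq_zero_right (h : IsBandit ρ θ b) {p : Fin K → ℝ} (hp : p ∈ orthant (Fin K))
    {x : Scenario b} (hpx : p x = 0) : D ρ θ b p x = 0 := by
  rw [h.D_eq hp x, lam_of_eq_zero_right hpx, KL_self h.nontrivial (h.mem b), hpx]
  ring

lemma D_of_eq_zero_left (h : IsBandit ρ θ b) {p : Fin K → ℝ} (hp : p ∈ orthant (Fin K))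
    {x : Scenario b} (hpb : p b = 0) : D ρ θ b p x = 0 := by
  by_cases hpx : p x = 0
  · exact h.D_of_eq_zero_right hp hpx
  · rw [h.D_eq hp x, lam_of_eq_zero_left hpb hpx, KL_self h.nontrivial (h.mem x), hpb]
    ring

lemma single_mem_orthant (i : Fin K) : (Pi.single i 1 : Fin K → ℝ) ∈ orthant (Fin K) := by
  intro j
  by_cases hj : j = i
  · subst hj
    simp
  · simp [hj]

lemma D_single (h : IsBandit ρ θ b) (i : Fin K) (x : Scenario b) :
    D ρ θ b (Pi.single i 1) x = 0 := by
  by_cases hi : i = b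
  · refine h.D_of_eq_zero_right (single_mem_orthant i) ?_
    subst hi
    simp [x.2]
  · refine h.D_of_eq_zero_left (single_mem_orthant i) ?_
    simp [Ne.symm hi]

lemma D_congr {p p' : Fin K → ℝ} {x : Scenario b} (hpb : p b = p' b) (hpx : p x = p' x) :
    D ρ θ b p x = D ρ θ b p' x := by
  simp only [D, hpb, hpx]

lemma D_smul {t : ℝ} (ht : 0 ≤ t) (p : Fin K → ℝ) (x : Scenario b) :
    D ρ θ b (t • p) x = t * D ρ θ b p x := by
  rw [D, D, ← smul_eq_mul, ← Real.sInf_smul_of_nonneg ht, ← image_smul, image_image]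
  congr 2
  ext l
  simp only [Pi.smul_apply, smul_eq_mul]
  ring

lemma continuousAt_lam {p : Fin K → ℝ} {x : Scenario b} (hpx : p b + p x ≠ 0) :
    ContinuousAt (fun p' => lam θ b p' x) p := by
  have h1 : ContinuousAt (fun p' : Fin K → ℝ => (p' b * θ b + p' x * θ x) / (p' b + p' x)) p :=
    ContinuousAt.div (by fun_prop) (by fun_prop) hpx
  refine h1.congr ?_
  have h2 : ∀ᶠ p' : Fin K → ℝ in 𝓝 p, p' b + p' x ≠ 0 :=
    (by fun_prop : ContinuousAt (fun p' : Fin K → ℝ => p' b + p' x) p).eventually_ne hpx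
  filter_upwards [h2] with p' hp'
  simp [lam, hp']

lemma continuousAt_KL_lam (h : IsBandit ρ θ b) {p : Fin K → ℝ} (hp : p ∈ orthant (Fin K))
    {x : Scenario b} (hpx : p b + p x ≠ 0) (i : Fin K) :
    ContinuousAt (fun p' => KL ρ (θ i) (lam θ b p' x)) p :=
  ContinuousAt.comp (f := fun p' => lam θ b p' x) (g := KL ρ (θ i))
    (hasDerivAt_KL h.nontrivial (h.mem i) (h.lam_mem_meanSpace hp x)).continuousAt
    (continuousAt_lam hpx)

/-- The derivative of the scenario payoff. -/
def derivD (ρ : Measure ℝ) (θ : Fin K → ℝ) (b : Fin K) (p : Fin K → ℝ) (x : Scenario b) :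
    (Fin K → ℝ) →L[ℝ] ℝ :=
  KL ρ (θ b) (lam θ b p x) • ContinuousLinearMap.proj b
    + KL ρ (θ x) (lam θ b p x) • ContinuousLinearMap.proj x.1

lemma derivD_apply (p v : Fin K → ℝ) (x : Scenario b) :
    derivD ρ θ b p x v
      = v b * KL ρ (θ b) (lam θ b p x) + v x * KL ρ (θ x) (lam θ b p x) := by
  simp [derivD, mul_comm]

lemma hasFDerivWithinAt_D (h : IsBandit ρ θ b) {p : Fin K → ℝ} (hp : p ∈ orthant (Fin K))
    {x : Scenario b} (hpx : p b + p x ≠ 0) :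
    HasFDerivWithinAt (fun p' => D ρ θ b p' x) (derivD ρ θ b p x) (orthant (Fin K)) p := by
  rw [hasFDerivWithinAt_iff_isLittleO, Asymptotics.isLittleO_iff]
  intro ε hε
  have hcb := (h.continuousAt_KL_lam hp hpx b).tendsto.eventually
    (Metric.ball_mem_nhds _ (half_pos hε))
  have hcx := (h.continuousAt_KL_lam hp hpx x).tendsto.eventually
    (Metric.ball_mem_nhds _ (half_pos hε))
  filter_upwards [nhdsWithin_le_nhds hcb, nhdsWithin_le_nhds hcx, self_mem_nhdsWithin]
    with p' h1 h2 hp'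
  rw [Real.dist_eq] at h1 h2
  have hup := h.D_le hp' x (h.lam_mem hp x)
  have hlow := h.D_le hp x (h.lam_mem hp' x)
  have eq1 := h.D_eq hp x
  have eq2 := h.D_eq hp' x
  have n1 : |p' b - p b| ≤ ‖p' - p‖ := norm_le_pi_norm (p' - p) b
  have n2 : |p' x - p x| ≤ ‖p' - p‖ := norm_le_pi_norm (p' - p) x
  rw [derivD_apply, Real.norm_eq_abs]
  simp only [Pi.sub_apply]
  set kb := KL ρ (θ b) (lam θ b p x)
  set kx := KL ρ (θ x) (lam θ b p x)
  set kb' := KL ρ (θ b) (lam θ b p' x)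
  set kx' := KL ρ (θ x) (lam θ b p' x)
  have m1 : |(p' b - p b) * (kb' - kb)| ≤ ‖p' - p‖ * (ε / 2) := by
    rw [abs_mul]
    gcongr
  have m2 : |(p' x - p x) * (kx' - kx)| ≤ ‖p' - p‖ * (ε / 2) := by
    rw [abs_mul]
    gcongr
  have m1' := abs_le.1 m1
  have m2' := abs_le.1 m2
  have hn := norm_nonneg (p' - p)
  rw [abs_le]
  constructor
  · nlinarith
  · nlinarith

lemma uniqueDiffOn_orthant : UniqueDiffOn ℝ (orthant (Fin K)) := by
  have : orthant (Fin K) = Set.pi univ fun _ => Ici (0 : ℝ) := by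
    ext p
    simp only [orthant, mem_ofPred_eq, Set.mem_pi, mem_univ, true_implies, mem_Ici]
  rw [this]
  exact UniqueDiffOn.univ_pi fun _ => uniqueDiffOn_Ici 0

end IsBandit

/-- The derivative along a ray contained in the domain on which the function is affine. -/
lemma hasFDerivWithinAt_apply_eq_of_ray {E : Type*} [NormedAddCommGroup E] [NormedSpace ℝ E]
    {f : E → ℝ} {f' : E →L[ℝ] ℝ} {s : Set E} {z d : E} {c : ℝ} (hf : HasFDerivWithinAt f f' s z)
    (hmem : ∀ t : ℝ, 0 ≤ t → z + t • d ∈ s) (hray : ∀ t : ℝ, 0 ≤ t → f (z + t • d) = f z + t * c) :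
    f' d = c := by
  have h1 : HasDerivWithinAt (fun t : ℝ => z + t • d) d (Ici 0) 0 := by
    have := ((hasDerivAt_id (0 : ℝ)).smul_const d).const_add z
    simpa using this.hasDerivWithinAt
  have h2 : HasDerivWithinAt (fun t : ℝ => f (z + t • d)) (f' d) (Ici 0) 0 := by
    have hf' : HasFDerivWithinAt f f' s (z + (0 : ℝ) • d) := by simpa using hf
    exact hf'.comp_hasDerivWithinAt (0 : ℝ) h1 fun t ht => hmem t ht
  have h3 : HasDerivWithinAt (fun t : ℝ => f (z + t • d)) c (Ici 0) 0 := by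
    have : HasDerivWithinAt (fun t : ℝ => f z + t * c) c (Ici 0) 0 := by
      simpa using (((hasDerivAt_id (0 : ℝ)).mul_const c).const_add (f z)).hasDerivWithinAt
    exact this.congr (fun t ht => hray t ht) (hray 0 le_rfl)
  exact (uniqueDiffOn_Ici (0 : ℝ) 0 self_mem_Ici).eq_deriv _ h2 h3

namespace IsBandit

lemma add_smul_mem_orthant {p d : Fin K → ℝ} (hp : p ∈ orthant (Fin K))
    (hd : d ∈ orthant (Fin K)) {t : ℝ} (ht : 0 ≤ t) : p + t • d ∈ orthant (Fin K) :=
  fun i => add_nonneg (hp i) (mul_nonneg ht (hd i))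

lemma D_add_smul_of_eq_zero {p d : Fin K → ℝ} {x : Scenario b} (hpb : p b = 0) (hpx : p x = 0)
    {t : ℝ} (ht : 0 ≤ t) : D ρ θ b (p + t • d) x = t * D ρ θ b d x := by
  rw [← D_smul ht]
  exact D_congr (by simp [hpb]) (by simp [hpx])

lemma eq_zero_of_add_eq_zero {p : Fin K → ℝ} (hp : p ∈ orthant (Fin K)) {x : Scenario b}
    (h0 : p b + p x = 0) : p b = 0 ∧ p x = 0 := by
  have h1 := hp b
  have h2 := hp x
  constructor <;> linarith

lemma KL_lam_le (h : IsBandit ρ θ b) {p : Fin K → ℝ} (hp : p ∈ orthant (Fin K))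
    (x : Scenario b) : KL ρ (θ b) (lam θ b p x) ≤ KL ρ (θ b) (θ x) ∧
      KL ρ (θ x) (lam θ b p x) ≤ KL ρ (θ x) (θ b) := by
  have h1 := h.lam_mem hp x
  have h2 := (h.lt x).le
  exact ⟨(strictAntiOn_KL h.nontrivial (h.mem b) (h.mem x)).antitoneOn (left_mem_Icc.2 h2) h1 h1.1,
    (strictMonoOn_KL h.nontrivial (h.mem x) (h.mem b)).monotoneOn h1 (right_mem_Icc.2 h2) h1.2⟩

/-- A common bound on all divergences that occur. -/
def klBound (ρ : Measure ℝ) (θ : Fin K → ℝ) (b : Fin K) : ℝ :=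
  ∑ x : Scenario b, (KL ρ (θ b) (θ x) + KL ρ (θ x) (θ b))

lemma KL_add_KL_le_klBound (x : Scenario b) :
    KL ρ (θ b) (θ x) + KL ρ (θ x) (θ b) ≤ klBound ρ θ b :=
  Finset.single_le_sum (f := fun x : Scenario b => KL ρ (θ b) (θ x) + KL ρ (θ x) (θ b))
    (fun _ _ => add_nonneg (KL_nonneg _ _) (KL_nonneg _ _)) (Finset.mem_univ x)

lemma klBound_nonneg : 0 ≤ klBound ρ θ b :=
  Finset.sum_nonneg fun _ _ => add_nonneg (KL_nonneg _ _) (KL_nonneg _ _)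

lemma abs_derivD_single_le (h : IsBandit ρ θ b) {p : Fin K → ℝ} (hp : p ∈ orthant (Fin K))
    (x : Scenario b) (i : Fin K) : |derivD ρ θ b p x (Pi.single i 1)| ≤ klBound ρ θ b := by
  have h1 := h.KL_lam_le hp x
  have h2 := KL_add_KL_le_klBound (ρ := ρ) (θ := θ) x
  have h3 : 0 ≤ KL ρ (θ b) (lam θ b p x) := KL_nonneg _ _
  have h4 : 0 ≤ KL ρ (θ x) (lam θ b p x) := KL_nonneg _ _
  have h7 : ∀ j : Fin K, 0 ≤ (Pi.single i 1 : Fin K → ℝ) j ∧ (Pi.single i 1 : Fin K → ℝ) j ≤ 1 := by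
    intro j
    refine ⟨single_mem_orthant i j, ?_⟩
    by_cases hj : j = i
    · subst hj; simp
    · simp [hj]
  obtain ⟨a1, a2⟩ := h7 b
  obtain ⟨a3, a4⟩ := h7 x
  rw [derivD_apply, abs_of_nonneg (by positivity)]
  nlinarith

lemma exists_isGradBound (h : IsBandit ρ θ b) : ∃ M : ℝ, IsGradBound ρ θ b M := by
  refine ⟨klBound ρ θ b, fun x p hp hdiff i => ?_⟩
  have hp' : p ∈ orthant (Fin K) := hp.1
  by_cases h0 : p b + p x = 0
  · obtain ⟨hpb, hpx⟩ := eq_zero_of_add_eq_zero hp' h0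
    have : fderivWithin ℝ (fun p' => D ρ θ b p' x) (orthant (Fin K)) p (Pi.single i 1) = 0 := by
      refine hasFDerivWithinAt_apply_eq_of_ray hdiff.hasFDerivWithinAt
        (fun t ht => add_smul_mem_orthant hp' (single_mem_orthant i) ht) fun t ht => ?_
      rw [D_add_smul_of_eq_zero hpb hpx ht, h.D_single, h.D_of_eq_zero_left hp' hpb]
      simp
    rw [this, abs_zero]
    exact klBound_nonneg
  · rw [(h.hasFDerivWithinAt_D hp' h0).fderivWithin (uniqueDiffOn_orthant p hp')]
    exact h.abs_derivD_single_le hp' x i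

lemma KL_lam_le_of_isGradBound (h : IsBandit ρ θ b) {M : ℝ} (hM : IsGradBound ρ θ b M)
    {p : Fin K → ℝ} (hp : p ∈ stdSimplex ℝ (Fin K)) {x : Scenario b} (h0 : p b + p x ≠ 0) :
    KL ρ (θ b) (lam θ b p x) ≤ M ∧ KL ρ (θ x) (lam θ b p x) ≤ M := by
  have hp' : p ∈ orthant (Fin K) := hp.1
  have hd := h.hasFDerivWithinAt_D hp' h0
  have key := hM x p hp hd.differentiableWithinAt
  rw [hd.fderivWithin (uniqueDiffOn_orthant p hp')] at key
  have hxb : (x : Fin K) ≠ b := x.2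
  constructor
  · have := (le_abs_self _).trans (key b)
    rw [derivD_apply] at this
    simpa [hxb] using this
  · have := (le_abs_self _).trans (key x)
    rw [derivD_apply] at this
    simpa [hxb.symm] using this

lemma isGradBound_pos (h : IsBandit ρ θ b) {M : ℝ} (hM : IsGradBound ρ θ b M) : 0 < M := by
  obtain ⟨x⟩ := h.nonempty
  have hxb : b ≠ (x : Fin K) := x.2.symm
  have h1 : (Pi.single x.1 1 : Fin K → ℝ) b = 0 := by simp [hxb]
  have h2 : (Pi.single x.1 1 : Fin K → ℝ) x = 1 := by simp
  have key := (h.KL_lam_le_of_isGradBound hM (single_mem_stdSimplex ℝ x.1) (x := x)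
    (by rw [h1, h2]; norm_num)).1
  rw [lam_of_eq_zero_left h1 (by rw [h2]; norm_num)] at key
  exact (KL_pos h.nontrivial (h.mem b) (h.mem x) (h.lt x).ne').trans_le key

end IsBandit

end Payoff

/-! ### Generalized gradients and oracles -/

section Oracles

variable {K : ℕ} {ρ : Measure ℝ} {θ : Fin K → ℝ} {b : Fin K}

namespace IsBandit

lemma gvec_scenario (p : Fin K → ℝ) (μ : Scenario b → ℝ) (x : Scenario b) :
    gvec ρ θ b p μ x = μ x * KL ρ (θ x) (lam θ b p x) := by
  rw [gvec, Finset.sum_eq_single x]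
  · have hxb : b ≠ (x : Fin K) := x.2.symm
    simp [hxb]
  · intro y _ hyx
    have hxb : b ≠ (x : Fin K) := x.2.symm
    have hyx' : (y : Fin K) ≠ x := fun h => hyx (Subtype.ext h)
    simp [hxb, hyx']
  · simp

lemma dotProduct_gvec (q p : Fin K → ℝ) (μ : Scenario b → ℝ) :
    q ⬝ᵥ gvec ρ θ b p μ = ∑ x, μ x * (q b * KL ρ (θ b) (lam θ b p x)
      + q x * KL ρ (θ x) (lam θ b p x)) := by
  simp only [dotProduct, gvec, Finset.mul_sum]
  rw [Finset.sum_comm]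
  refine Finset.sum_congr rfl fun x _ => ?_
  simp only [Pi.single_apply, ite_mul, one_mul, zero_mul, mul_add, mul_ite, mul_zero,
    Finset.sum_add_distrib, Finset.sum_ite_eq, Finset.mem_univ, if_true]
  ring

lemma payoff_eq_dotProduct (h : IsBandit ρ θ b) {p : Fin K → ℝ} (hp : p ∈ orthant (Fin K))
    (μ : Scenario b → ℝ) : payoff ρ θ b (p, μ) = p ⬝ᵥ gvec ρ θ b p μ := by
  rw [dotProduct_gvec]
  exact Finset.sum_congr rfl fun x _ => by rw [h.D_eq hp x]

/-- The derivative of a weighted scenario payoff in both variables. -/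
def derivMulD (ρ : Measure ℝ) (θ : Fin K → ℝ) (b : Fin K) (z : (Fin K → ℝ) × (Scenario b → ℝ))
    (x : Scenario b) : (Fin K → ℝ) × (Scenario b → ℝ) →L[ℝ] ℝ :=
  z.2 x • (derivD ρ θ b z.1 x).comp (ContinuousLinearMap.fst ℝ (Fin K → ℝ) (Scenario b → ℝ))
    + D ρ θ b z.1 x • (ContinuousLinearMap.proj (R := ℝ) (φ := fun _ : Scenario b => ℝ) x).comp
      (ContinuousLinearMap.snd ℝ (Fin K → ℝ) (Scenario b → ℝ))

lemma hasFDerivWithinAt_mul_D (h : IsBandit ρ θ b) {z : (Fin K → ℝ) × (Scenario b → ℝ)}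
    (hz : z.1 ∈ orthant (Fin K)) {x : Scenario b} (hx : z.1 b + z.1 x ≠ 0) :
    HasFDerivWithinAt (fun z : (Fin K → ℝ) × (Scenario b → ℝ) => z.2 x * D ρ θ b z.1 x)
      (derivMulD ρ θ b z x) (orthant (Fin K) ×ˢ univ) z := by
  have h1 : HasFDerivWithinAt (fun z : (Fin K → ℝ) × (Scenario b → ℝ) => z.2 x)
      ((ContinuousLinearMap.proj (R := ℝ) (φ := fun _ : Scenario b => ℝ) x).comp
        (ContinuousLinearMap.snd ℝ (Fin K → ℝ) (Scenario b → ℝ))) (orthant (Fin K) ×ˢ univ) z :=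
    (hasFDerivAt_apply (𝕜 := ℝ) (F' := fun _ : Scenario b => ℝ) x
      z.2).comp_hasFDerivWithinAt z hasFDerivWithinAt_snd
  have h2 : HasFDerivWithinAt (fun z : (Fin K → ℝ) × (Scenario b → ℝ) => D ρ θ b z.1 x)
      ((derivD ρ θ b z.1 x).comp (ContinuousLinearMap.fst ℝ _ _))
      (orthant (Fin K) ×ˢ univ) z :=
    (h.hasFDerivWithinAt_D hz hx).comp z hasFDerivWithinAt_fst fun y hy => hy.1
  exact h1.mul h2

lemma differentiableWithinAt_payoff (h : IsBandit ρ θ b) {z : (Fin K → ℝ) × (Scenario b → ℝ)}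
    (hz : z.1 ∈ orthant (Fin K)) (hx : ∀ x : Scenario b, z.1 b + z.1 x ≠ 0) :
    DifferentiableWithinAt ℝ (payoff ρ θ b) (orthant (Fin K) ×ˢ univ) z :=
  DifferentiableWithinAt.fun_sum fun x _ =>
    (h.hasFDerivWithinAt_mul_D hz (hx x)).differentiableWithinAt

lemma differentiableAt_payoff (h : IsBandit ρ θ b) {p : Fin K → ℝ} (hp : ∀ i, 0 < p i)
    (μ : Scenario b → ℝ) : DifferentiableAt ℝ (payoff ρ θ b) (p, μ) := by
  refine (h.differentiableWithinAt_payoff (z := (p, μ)) (fun i => (hp i).le)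
    fun x => (add_pos (hp b) (hp x)).ne').differentiableAt (prod_mem_nhds ?_ univ_mem)
  have h1 : ∀ᶠ p' : Fin K → ℝ in 𝓝 p, ∀ i, 0 < p' i :=
    eventually_all.2 fun i => (continuous_apply i).continuousAt.eventually (lt_mem_nhds (hp i))
  filter_upwards [h1] with p' hp' i using (hp' i).le

/-- At a point of differentiability only scenarios of weight zero are degenerate, and the
gradient is given by `gvec`. -/
lemma gradP_eq_gvec (h : IsBandit ρ θ b) {z : (Fin K → ℝ) × (Scenario b → ℝ)}
    (hz : z ∈ diffSet (payoff ρ θ b)) : gradP (payoff ρ θ b) z = gvec ρ θ b z.1 z.2 := by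
  obtain ⟨hz1, hz2, hdiff⟩ := hz
  have hp : z.1 ∈ orthant (Fin K) := hz1.1
  classical
  set S : Finset (Scenario b) := Finset.univ.filter fun x => z.1 b + z.1 x = 0 with hS
  set R : (Fin K → ℝ) × (Scenario b → ℝ) → ℝ := fun y => ∑ x ∈ S, y.2 x * D ρ θ b y.1 x with hR
  set Q : (Fin K → ℝ) × (Scenario b → ℝ) → ℝ := fun y => ∑ x ∈ Sᶜ, y.2 x * D ρ θ b y.1 x with hQ
  have hsplit : ∀ y, payoff ρ θ b y = R y + Q y := fun y => (Finset.sum_add_sum_compl S _).symm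
  have hQd := HasFDerivWithinAt.fun_sum (u := Sᶜ) fun x hx =>
    h.hasFDerivWithinAt_mul_D (z := z) hp (x := x) (by simpa [hS] using hx)
  set Q' := ∑ x ∈ Sᶜ, derivMulD ρ θ b z x with hQ'
  have hRd : HasFDerivWithinAt R (fderivWithin ℝ (payoff ρ θ b) (orthant (Fin K) ×ˢ univ) z - Q')
      (orthant (Fin K) ×ˢ univ) z := by
    refine (hdiff.hasFDerivWithinAt.sub hQd).congr (fun y _ => ?_) ?_
    · simp [hsplit, hQ]
    · simp [hsplit, hQ]
  have hzero : ∀ x ∈ S, z.1 b = 0 ∧ z.1 x = 0 := fun x hx =>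
    eq_zero_of_add_eq_zero hp (by simpa [hS] using hx)
  have hray : ∀ d ∈ orthant (Fin K),
      (fderivWithin ℝ (payoff ρ θ b) (orthant (Fin K) ×ˢ univ) z - Q') (d, 0) = R (d, z.2) := by
    intro d hd
    refine hasFDerivWithinAt_apply_eq_of_ray hRd (fun t ht => ?_) fun t ht => ?_
    · exact ⟨add_smul_mem_orthant hp hd ht, mem_univ _⟩
    · have h1 : R z = 0 := Finset.sum_eq_zero fun x hx => by
        rw [h.D_of_eq_zero_left hp (hzero x hx).1, mul_zero]
      rw [h1, zero_add]
      simp only [hR, Finset.mul_sum, Prod.snd_add, Prod.fst_add, Prod.smul_snd, Prod.smul_fst,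
        smul_zero, add_zero]
      refine Finset.sum_congr rfl fun x hx => ?_
      rw [D_add_smul_of_eq_zero (hzero x hx).1 (hzero x hx).2 ht]
      ring
  have hsingle : ∀ i : Fin K,
      (fderivWithin ℝ (payoff ρ θ b) (orthant (Fin K) ×ˢ univ) z - Q') (Pi.single i 1, 0) = 0 := by
    intro i
    rw [hray _ (single_mem_orthant i)]
    exact Finset.sum_eq_zero fun x _ => by simp only [h.D_single, mul_zero]
  have hmu : ∀ x ∈ S, z.2 x = 0 := by
    intro x hx
    have hd : (Pi.single b 1 + Pi.single x.1 1 : Fin K → ℝ) ∈ orthant (Fin K) := fun i =>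
      add_nonneg (single_mem_orthant b i) (single_mem_orthant x.1 i)
    have h1 := hray _ hd
    have h2 : ((Pi.single b 1 + Pi.single x.1 1 : Fin K → ℝ), (0 : Scenario b → ℝ))
        = (Pi.single b 1, 0) + (Pi.single x.1 1, 0) := by simp
    rw [h2, map_add, hsingle, hsingle, add_zero] at h1
    have h3 : ∀ y ∈ S, 0 ≤ z.2 y * D ρ θ b (Pi.single b 1 + Pi.single x.1 1) y := fun y _ =>
      mul_nonneg (hz2.1 y) (h.D_nonneg hd y)
    have h4 := (Finset.sum_eq_zero_iff_of_nonneg h3).1 h1.symm x hx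
    have hxb : (x : Fin K) ≠ b := x.2
    have h5 : 0 < D ρ θ b (Pi.single b 1 + Pi.single x.1 1) x :=
      h.D_pos hd x (by simp [hxb.symm]) (by simp [hxb])
    exact (mul_eq_zero.1 h4).resolve_right h5.ne'
  ext i
  have h1 := hsingle i
  rw [sub_apply, sub_eq_zero] at h1
  rw [gradP, h1, gvec, ← Finset.sum_add_sum_compl S,
    Finset.sum_eq_zero (s := S) fun x hx => by rw [hmu x hx, zero_mul], zero_add]
  simp [hQ', derivMulD, derivD_apply]

lemma continuousAt_gvec (h : IsBandit ρ θ b) {z : (Fin K → ℝ) × (Scenario b → ℝ)}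
    (hz : z.1 ∈ orthant (Fin K)) (hb0 : z.1 b ≠ 0) :
    ContinuousAt (fun z : (Fin K → ℝ) × (Scenario b → ℝ) => gvec ρ θ b z.1 z.2) z := by
  rw [continuousAt_pi]
  intro i
  refine tendsto_finsetSum _ fun x _ => ?_
  have hx : z.1 b + z.1 x ≠ 0 :=
    (add_pos_of_pos_of_nonneg (lt_of_le_of_ne (hz b) hb0.symm) (hz x)).ne'
  have hk : ∀ j : Fin K, ContinuousAt
      (fun z : (Fin K → ℝ) × (Scenario b → ℝ) => KL ρ (θ j) (lam θ b z.1 x)) z := fun j =>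
    ContinuousAt.comp (f := Prod.fst) (g := fun p => KL ρ (θ j) (lam θ b p x))
      (h.continuousAt_KL_lam hz hx j) continuousAt_fst
  have hm : ContinuousAt (fun z : (Fin K → ℝ) × (Scenario b → ℝ) => z.2 x) z := by fun_prop
  exact hm.mul (((hk b).const_mul _).add ((hk x).const_mul _))

lemma clarkeP_subset_of_pos (h : IsBandit ρ θ b) {z : (Fin K → ℝ) × (Scenario b → ℝ)}
    (hz : z.1 ∈ orthant (Fin K)) (hb0 : z.1 b ≠ 0) :
    clarkeP (payoff ρ θ b) z ⊆ {gvec ρ θ b z.1 z.2} := by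
  refine convexHull_min ?_ (convex_singleton _)
  rintro f ⟨u, hu, hlim, hgrad⟩
  have h1 : Tendsto (fun n => gradP (payoff ρ θ b) (u n)) atTop (𝓝 (gvec ρ θ b z.1 z.2)) := by
    simp_rw [fun n => h.gradP_eq_gvec (hu n)]
    exact (h.continuousAt_gvec hz hb0).tendsto.comp hlim
  exact tendsto_nhds_unique hgrad h1

lemma clarkeP_apply_eq_zero (h : IsBandit ρ θ b) {z : (Fin K → ℝ) × (Scenario b → ℝ)}
    (hz : z.1 ∈ orthant (Fin K)) (hb0 : z.1 b = 0) {y : Scenario b} (hy : z.1 y ≠ 0)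
    {f : Fin K → ℝ} (hf : f ∈ clarkeP (payoff ρ θ b) z) : f y = 0 := by
  have hconv : Convex ℝ {f : Fin K → ℝ | f y = 0} :=
    convex_hyperplane (f := fun f : Fin K → ℝ => f y) ⟨fun _ _ => rfl, fun _ _ => rfl⟩ 0
  refine convexHull_min ?_ hconv hf
  rintro f ⟨u, hu, hlim, hgrad⟩
  have h1 : Tendsto (fun n => gradP (payoff ρ θ b) (u n) y) atTop
      (𝓝 (z.2 y * KL ρ (θ y) (lam θ b z.1 y))) := by
    simp_rw [fun n => h.gradP_eq_gvec (hu n), gvec_scenario]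
    have hk : ContinuousAt
        (fun z : (Fin K → ℝ) × (Scenario b → ℝ) => KL ρ (θ y) (lam θ b z.1 y)) z :=
      ContinuousAt.comp (f := Prod.fst) (g := fun p => KL ρ (θ y) (lam θ b p y))
        (h.continuousAt_KL_lam hz (by rwa [hb0, zero_add]) y) continuousAt_fst
    have hm : ContinuousAt (fun z : (Fin K → ℝ) × (Scenario b → ℝ) => z.2 y) z := by fun_prop
    exact (hm.mul hk).tendsto.comp hlim
  rw [lam_of_eq_zero_left hb0 hy, KL_self h.nontrivial (h.mem y), mul_zero] at h1
  exact tendsto_nhds_unique ((continuous_apply y.1).continuousAt.tendsto.comp hgrad) h1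

lemma kappa_le (x : Scenario b) {l : ℝ} (hl : l ∈ Icc (θ x) (θ b)) :
    kappa ρ θ b x ≤ max (KL ρ (θ x) l) (KL ρ (θ b) l) := by
  refine csInf_le ⟨0, ?_⟩ ⟨l, hl, rfl⟩
  rintro _ ⟨l', _, rfl⟩
  exact le_max_of_le_left (KL_nonneg _ _)

lemma kappa_pos (h : IsBandit ρ θ b) (x : Scenario b) : 0 < kappa ρ θ b x := by
  have hcont : ContinuousOn (fun l => max (KL ρ (θ x) l) (KL ρ (θ b) l)) (Icc (θ x) (θ b)) :=
    ((continuousOn_KL h.nontrivial (h.mem x)).mono (h.Icc_subset x)).sup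
      ((continuousOn_KL h.nontrivial (h.mem b)).mono (h.Icc_subset x))
  obtain ⟨l, hl, hleq⟩ := (isCompact_Icc.image_of_continuousOn hcont).sInf_mem
    ((nonempty_Icc.2 (h.lt x).le).image _)
  rw [kappa, ← hleq]
  exact h.max_KL_pos x hl

lemma kappaMin_le (x : Scenario b) : kappaMin ρ θ b ≤ kappa ρ θ b x :=
  ciInf_le (Set.finite_range _).bddBelow x

lemma kappaMin_pos (h : IsBandit ρ θ b) : 0 < kappaMin ρ θ b := by
  have := h.nonempty
  obtain ⟨x, hx⟩ := exists_eq_ciInf_of_finite (f := fun x : Scenario b => kappa ρ θ b x)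
  rw [kappaMin, ← hx]
  exact h.kappa_pos x

lemma kappaMin_le_sum_gvec (h : IsBandit ρ θ b) {p : Fin K → ℝ} (hp : p ∈ orthant (Fin K))
    {μ : Scenario b → ℝ} (hμ : μ ∈ stdSimplex ℝ (Scenario b)) :
    kappaMin ρ θ b ≤ ∑ i, gvec ρ θ b p μ i := by
  have h1 : ∑ i, gvec ρ θ b p μ i = (1 : Fin K → ℝ) ⬝ᵥ gvec ρ θ b p μ := by simp [dotProduct]
  rw [h1, dotProduct_gvec, ← one_mul (kappaMin ρ θ b), ← hμ.2, Finset.sum_mul]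
  refine Finset.sum_le_sum fun x _ => mul_le_mul_of_nonneg_left ?_ (hμ.1 x)
  refine ((kappaMin_le x).trans (kappa_le x (h.lam_mem hp x))).trans ?_
  have h3 : 0 ≤ KL ρ (θ b) (lam θ b p x) := KL_nonneg _ _
  have h4 : 0 ≤ KL ρ (θ x) (lam θ b p x) := KL_nonneg _ _
  simp only [Pi.one_apply, one_mul]
  exact max_le (by linarith) (by linarith)

lemma kappaMin_le_sum_of_mem_clarkeP (h : IsBandit ρ θ b)
    {z : (Fin K → ℝ) × (Scenario b → ℝ)} {f : Fin K → ℝ}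
    (hf : f ∈ clarkeP (payoff ρ θ b) z) : kappaMin ρ θ b ≤ ∑ i, f i := by
  have hconv : Convex ℝ {f : Fin K → ℝ | kappaMin ρ θ b ≤ ∑ i, f i} :=
    convex_halfSpace_ge (f := fun f : Fin K → ℝ => ∑ i, f i)
      ⟨fun f g => by simp [Finset.sum_add_distrib], fun c f => by simp [Finset.mul_sum]⟩ _
  refine convexHull_min ?_ hconv hf
  rintro f ⟨u, hu, _, hgrad⟩
  have hcont : Continuous fun f : Fin K → ℝ => ∑ i, f i := by fun_prop
  refine ge_of_tendsto (hcont.continuousAt.tendsto.comp hgrad) (Eventually.of_forall fun n => ?_)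
  simp only [Function.comp_apply]
  rw [h.gradP_eq_gvec (hu n)]
  exact h.kappaMin_le_sum_gvec (hu n).1.1 (hu n).2.1

lemma LMOp_subset_stdSimplex {z : (Fin K → ℝ) × (Scenario b → ℝ)} :
    LMOp (payoff ρ θ b) z ⊆ stdSimplex ℝ (Fin K) :=
  convexHull_min (fun _ hq => hq.1) (convex_stdSimplex ℝ _)

lemma gvec_le_of_mem_LMOp (h : IsBandit ρ θ b) {z : (Fin K → ℝ) × (Scenario b → ℝ)}
    (hz : z.1 ∈ orthant (Fin K)) (hb0 : z.1 b ≠ 0) {q : Fin K → ℝ}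
    (hq : q ∈ LMOp (payoff ρ θ b) z) (i : Fin K) :
    gvec ρ θ b z.1 z.2 i ≤ q ⬝ᵥ gvec ρ θ b z.1 z.2 := by
  have hconv : Convex ℝ {q : Fin K → ℝ | gvec ρ θ b z.1 z.2 i ≤ q ⬝ᵥ gvec ρ θ b z.1 z.2} :=
    convex_halfSpace_ge (f := fun q : Fin K → ℝ => q ⬝ᵥ gvec ρ θ b z.1 z.2)
      ⟨fun _ _ => add_dotProduct _ _ _, fun _ _ => smul_dotProduct _ _ _⟩ _
  refine convexHull_min ?_ hconv hq
  rintro q ⟨_, f, hf, hmax⟩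
  obtain rfl := h.clarkeP_subset_of_pos hz hb0 hf
  have := hmax _ (single_mem_stdSimplex ℝ i)
  rwa [single_one_dotProduct] at this

lemma apply_eq_zero_of_mem_LMOp (h : IsBandit ρ θ b) {z : (Fin K → ℝ) × (Scenario b → ℝ)}
    (hz : z.1 ∈ orthant (Fin K)) (hb0 : z.1 b = 0) {y : Scenario b} (hy : z.1 y ≠ 0)
    {q : Fin K → ℝ} (hq : q ∈ LMOp (payoff ρ θ b) z) : q y = 0 := by
  have hconv : Convex ℝ {f : Fin K → ℝ | f y = 0} :=
    convex_hyperplane (f := fun f : Fin K → ℝ => f y) ⟨fun _ _ => rfl, fun _ _ => rfl⟩ 0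
  refine convexHull_min ?_ hconv hq
  rintro q ⟨hqs, f, hf, hmax⟩
  have hfy := h.clarkeP_apply_eq_zero hz hb0 hy hf
  have hsum := h.kappaMin_pos.trans_le (h.kappaMin_le_sum_of_mem_clarkeP hf)
  obtain ⟨i, -, hi⟩ := Finset.exists_lt_of_sum_lt (s := Finset.univ) (f := fun _ : Fin K => (0 : ℝ))
    (g := f) (by simpa using hsum)
  set m := q ⬝ᵥ f with hm
  have hle : ∀ j, f j ≤ m := fun j => by
    have := hmax _ (single_mem_stdSimplex ℝ j)
    rwa [single_one_dotProduct] at this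
  have hm0 : 0 < m := hi.trans_le (hle i)
  have hz0 : ∑ j, q j * (m - f j) = 0 := by
    simp_rw [mul_sub]
    rw [Finset.sum_sub_distrib, ← Finset.sum_mul, hqs.2, one_mul, hm, dotProduct, sub_self]
  have := (Finset.sum_eq_zero_iff_of_nonneg fun j _ =>
    mul_nonneg (hqs.1 j) (sub_nonneg.2 (hle j))).1 hz0 y (Finset.mem_univ _)
  rw [hfy, sub_zero] at this
  exact (mul_eq_zero.1 this).resolve_right hm0.ne'

lemma gradMu_eq (z : (Fin K → ℝ) × (Scenario b → ℝ)) :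
    gradMu (payoff ρ θ b) z = D ρ θ b z.1 := by
  ext x
  have h1 : HasFDerivAt (fun μ : Scenario b → ℝ => payoff ρ θ b (z.1, μ))
      (∑ x : Scenario b, D ρ θ b z.1 x • (ContinuousLinearMap.proj x :
        (Scenario b → ℝ) →L[ℝ] ℝ)) z.2 := by
    refine HasFDerivAt.fun_sum fun x _ => ?_
    exact (hasFDerivAt_apply (𝕜 := ℝ) (F' := fun _ : Scenario b => ℝ) x z.2).mul_const
      (D ρ θ b z.1 x)
  rw [gradMu, h1.fderiv]
  simp [Pi.single_apply]

lemma dotProduct_D_le_of_mem_LMOmu {z : (Fin K → ℝ) × (Scenario b → ℝ)} {ν : Scenario b → ℝ}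
    (hν : ν ∈ LMOmu (payoff ρ θ b) z) (x : Scenario b) :
    ν ⬝ᵥ D ρ θ b z.1 ≤ D ρ θ b z.1 x := by
  have := hν.2 _ (single_mem_stdSimplex ℝ x)
  rwa [gradMu_eq, single_one_dotProduct] at this

end IsBandit

end Oracles

/-! ### Absolutely continuous functions -/

section AbsolutelyContinuous

/-- Composition of a Lipschitz function with an absolutely continuous one. -/
lemma _root_.AbsolutelyContinuousOnInterval.lipschitz_comp {X Y : Type*} [PseudoMetricSpace X]
    [PseudoMetricSpace Y] {f : ℝ → X} {g : X → Y} {C : NNReal} {S : Set X} {s t : ℝ}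
    (hf : AbsolutelyContinuousOnInterval f s t) (hg : LipschitzOnWith C g S)
    (hS : MapsTo f (uIcc s t) S) : AbsolutelyContinuousOnInterval (fun r => g (f r)) s t := by
  rw [absolutelyContinuousOnInterval_iff] at hf ⊢
  intro ε hε
  obtain ⟨δ, hδ, h⟩ := hf (ε / (C + 1)) (by positivity)
  refine ⟨δ, hδ, fun E hE hlen => ?_⟩
  calc ∑ i ∈ Finset.range E.1, dist (g (f (E.2 i).1)) (g (f (E.2 i).2))
      ≤ ∑ i ∈ Finset.range E.1, C * dist (f (E.2 i).1) (f (E.2 i).2) :=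
        Finset.sum_le_sum fun i hi =>
          hg.dist_le_mul _ (hS (hE.1 i hi).1) _ (hS (hE.1 i hi).2)
    _ = C * ∑ i ∈ Finset.range E.1, dist (f (E.2 i).1) (f (E.2 i).2) :=
        (Finset.mul_sum _ _ _).symm
    _ ≤ C * (ε / (C + 1)) := by
        gcongr
        exact (h E hE hlen).le
    _ < (C + 1) * (ε / (C + 1)) := by
        gcongr
        linarith
    _ = ε := by field_simp

lemma _root_.AbsolutelyContinuousOnInterval.apply {ι : Type*} [Fintype ι] {f : ℝ → ι → ℝ} {s t : ℝ}
    (hf : AbsolutelyContinuousOnInterval f s t) (i : ι) :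
    AbsolutelyContinuousOnInterval (fun r => f r i) s t :=
  AbsolutelyContinuousOnInterval.lipschitz_comp hf
    (g := fun v : ι → ℝ => v i)
    ((LipschitzWith.eval (α := fun _ : ι => ℝ) i).lipschitzOnWith (s := univ)) (mapsTo_univ _ _)

lemma absolutelyContinuousOnInterval_const {X : Type*} [PseudoMetricSpace X] (c : X) (s t : ℝ) :
    AbsolutelyContinuousOnInterval (fun _ => c) s t :=
  ((LipschitzWith.const c).lipschitzOnWith (s := uIcc s t)).absolutelyContinuousOnInterval

lemma _root_.AbsolutelyContinuousOnInterval.finset_sum {ι : Type*} {S : Finset ι} {f : ι → ℝ → ℝ}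
    {s t : ℝ} (hf : ∀ i ∈ S, AbsolutelyContinuousOnInterval (f i) s t) :
    AbsolutelyContinuousOnInterval (fun r => ∑ i ∈ S, f i r) s t := by
  classical
  induction S using Finset.induction_on with
  | empty => simpa using absolutelyContinuousOnInterval_const (0 : ℝ) s t
  | insert a S ha ih =>
    simp_rw [Finset.sum_insert ha]
    exact (hf a (Finset.mem_insert_self a S)).add
      (ih fun i hi => hf i (Finset.mem_insert_of_mem hi))

lemma _root_.AbsolutelyContinuousOnInterval.sup {f g : ℝ → ℝ} {s t : ℝ}
    (hf : AbsolutelyContinuousOnInterval f s t) (hg : AbsolutelyContinuousOnInterval g s t) :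
    AbsolutelyContinuousOnInterval (f ⊔ g) s t := by
  have habs : AbsolutelyContinuousOnInterval (fun r => |f r - g r|) s t :=
    AbsolutelyContinuousOnInterval.lipschitz_comp (hf.sub hg) (g := fun y : ℝ => |y|)
      (lipschitzWith_one_norm.lipschitzOnWith (s := univ)) (mapsTo_univ _ _)
  have h2 := ((hf.add hg).add habs).const_mul (1 / 2)
  convert h2 using 1
  ext r
  simp only [Pi.sup_apply, Pi.add_apply]
  rcases le_total (f r) (g r) with h | h
  · rw [max_eq_right h, abs_of_nonpos (by linarith)]
    ring
  · rw [max_eq_left h, abs_of_nonneg (by linarith)]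
    ring

/-- An absolutely continuous function decreasing at unit relative rate decays exponentially. -/
lemma le_exp_mul_of_deriv_le {w : ℝ → ℝ} {s t : ℝ} (hst : s ≤ t)
    (hw : AbsolutelyContinuousOnInterval w s t)
    (hd : ∀ᵐ r, r ∈ Ioo s t → ∃ w', HasDerivAt w w' r ∧ w' ≤ -w r) :
    w t ≤ Real.exp (-(t - s)) * w s := by
  have hexp : AbsolutelyContinuousOnInterval Real.exp s t :=
    Real.contDiff_exp.contDiffOn.absolutelyContinuousOnInterval
  have hint := (hexp.fun_mul hw).integral_deriv_eq_sub
  have hle : ∫ r in s..t, deriv (fun r => Real.exp r * w r) r ≤ 0 := by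
    rw [intervalIntegral.integral_of_le hst, integral_Ioc_eq_integral_Ioo]
    refine integral_nonpos_of_ae ?_
    rw [EventuallyLE, ae_restrict_iff' measurableSet_Ioo]
    filter_upwards [hd] with r hr hmem
    obtain ⟨w', h1, h2⟩ := hr hmem
    rw [((Real.hasDerivAt_exp r).fun_mul h1).deriv]
    have := Real.exp_pos r
    simp only [Pi.zero_apply]
    nlinarith
  rw [hint] at hle
  have h3 : Real.exp (-(t - s)) = Real.exp s / Real.exp t := by
    rw [← Real.exp_sub]
    ring_nf
  rw [h3, div_mul_eq_mul_div, le_div_iff₀ (Real.exp_pos t)]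
  linarith

lemma exists_mem_Ioo_of_ae {P : ℝ → Prop} (h : ∀ᵐ r, P r) {s t : ℝ} (hst : s < t) :
    ∃ r ∈ Ioo s t, P r := by
  obtain ⟨r, hr, hP⟩ := (Measure.dense_of_ae h).exists_mem_open isOpen_Ioo (nonempty_Ioo.2 hst)
  exact ⟨r, hP, hr⟩

end AbsolutelyContinuous

/-! ### Relaxation towards moving targets in a simplex -/

section Relaxation

/-- If a coordinate vanishes around a time, so does that of the target. -/
lemma target_eq_zero {ι : Type*} {y : ℝ → ι → ℝ} {q : ι → ℝ} {r s t : ℝ}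
    (hd : HasDerivAt y (q - y r) r) (hr : r ∈ Ioo s t) {i : ι}
    (hzero : ∀ r ∈ Ioo s t, y r i = 0) : q i = 0 := by
  have h1 : HasDerivAt (fun r => y r i) 0 r := by
    refine (hasDerivAt_const r (0 : ℝ)).congr_of_eventuallyEq ?_
    filter_upwards [isOpen_Ioo.mem_nhds hr] with r' hr' using hzero r' hr'
  have h2 := (hasDerivAt_pi.1 hd i).unique h1
  rw [Pi.sub_apply, hzero r hr] at h2
  linarith

variable {ι : Type} [Fintype ι]

/-- `y` starts in the simplex and moves at almost every time towards a point of the simplex. -/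
structure IsRelaxation (y : ℝ → ι → ℝ) : Prop where
  ac : ∀ T : ℝ, 0 ≤ T → AbsolutelyContinuousOnInterval y 0 T
  start : y 0 ∈ stdSimplex ℝ ι
  deriv : ∀ᵐ r : ℝ, 0 ≤ r → ∃ q ∈ stdSimplex ℝ ι, HasDerivAt y (q - y r) r

namespace IsRelaxation

variable {y : ℝ → ι → ℝ}

lemma ac_Icc (hy : IsRelaxation y) {s t : ℝ} (hs : 0 ≤ s) (hst : s ≤ t) :
    AbsolutelyContinuousOnInterval y s t := by
  refine (hy.ac t (hs.trans hst)).mono ?_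
  rw [uIcc_of_le hst, uIcc_of_le (hs.trans hst)]
  exact Icc_subset_Icc_left hs

lemma exp_mul_le (hy : IsRelaxation y) {s t : ℝ} (hs : 0 ≤ s) (hst : s ≤ t) (i : ι) :
    Real.exp (-(t - s)) * y s i ≤ y t i := by
  have h1 : -y t i ≤ Real.exp (-(t - s)) * (-y s i) := by
    refine le_exp_mul_of_deriv_le (w := fun r => -y r i) hst
      (AbsolutelyContinuousOnInterval.apply (hy.ac_Icc hs hst) i).neg ?_
    filter_upwards [hy.deriv] with r hr hmem
    obtain ⟨q, hq, hd⟩ := hr (hs.trans hmem.1.le)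
    refine ⟨_, (hasDerivAt_pi.1 hd i).neg, ?_⟩
    have := hq.1 i
    simp only [Pi.sub_apply]
    linarith
  linarith

lemma nonneg (hy : IsRelaxation y) {t : ℝ} (ht : 0 ≤ t) (i : ι) : 0 ≤ y t i :=
  (mul_nonneg (Real.exp_pos _).le (hy.start.1 i)).trans (hy.exp_mul_le le_rfl ht i)

lemma pos_of_pos (hy : IsRelaxation y) {s t : ℝ} (hs : 0 ≤ s) (hst : s ≤ t) {i : ι}
    (hi : 0 < y s i) : 0 < y t i :=
  (mul_pos (Real.exp_pos _) hi).trans_le (hy.exp_mul_le hs hst i)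

lemma eq_zero_of_eq_zero (hy : IsRelaxation y) {s t : ℝ} (hs : 0 ≤ s) (hst : s ≤ t) {i : ι}
    (hi : y t i = 0) : y s i = 0 := by
  by_contra h
  exact (hy.pos_of_pos hs hst (lt_of_le_of_ne (hy.nonneg hs i) (Ne.symm h))).ne' hi

lemma sum_eq_one (hy : IsRelaxation y) {t : ℝ} (ht : 0 ≤ t) : ∑ i, y t i = 1 := by
  have hac : AbsolutelyContinuousOnInterval (fun r => ∑ i, y r i - 1) 0 t :=
    (AbsolutelyContinuousOnInterval.finset_sum fun i _ =>
      AbsolutelyContinuousOnInterval.apply (hy.ac_Icc le_rfl ht) i).sub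
      (absolutelyContinuousOnInterval_const 1 0 t)
  have hd : ∀ᵐ r, r ∈ Ioo 0 t →
      HasDerivAt (fun r => ∑ i, y r i - 1) (-(∑ i, y r i - 1)) r := by
    filter_upwards [hy.deriv] with r hr hmem
    obtain ⟨q, hq, hd⟩ := hr hmem.1.le
    refine ((HasDerivAt.fun_sum fun i (_ : i ∈ Finset.univ) =>
      hasDerivAt_pi.1 hd i).sub_const 1).congr_deriv ?_
    simp only [Pi.sub_apply]
    rw [Finset.sum_sub_distrib, hq.2]
    ring
  have h1 := le_exp_mul_of_deriv_le ht hac (hd.mono fun r hr hmem => ⟨_, hr hmem, le_rfl⟩)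
  have h2 := le_exp_mul_of_deriv_le ht hac.neg
    (hd.mono fun r hr hmem => ⟨_, (hr hmem).neg, by simp⟩)
  simp only [Pi.neg_apply, hy.start.2, sub_self, mul_zero, neg_zero] at h1 h2
  linarith

lemma mem_stdSimplex (hy : IsRelaxation y) {t : ℝ} (ht : 0 ≤ t) : y t ∈ stdSimplex ℝ ι :=
  ⟨hy.nonneg ht, hy.sum_eq_one ht⟩

/-- Coordinates positive at a time are positive shortly before. -/
lemma exists_pos_before (hy : IsRelaxation y) {t : ℝ} (ht : 0 < t) :
    ∃ s ∈ Ioo 0 t, ∀ i, 0 < y t i → 0 < y s i := by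
  have hc : ContinuousWithinAt y (Ioo 0 t) t := by
    have h1 := (hy.ac t ht.le).continuousOn
    rw [uIcc_of_le ht.le] at h1
    exact (h1 t (right_mem_Icc.2 ht.le)).mono Ioo_subset_Icc_self
  have h2 : ∀ᶠ s in 𝓝[Ioo 0 t] t, ∀ i, 0 < y t i → 0 < y s i := by
    refine eventually_all.2 fun i => ?_
    by_cases hi : 0 < y t i
    · have h3 : Tendsto (fun s => y s i) (𝓝[Ioo 0 t] t) (𝓝 (y t i)) :=
        ((continuous_apply i).tendsto _).comp hc
      filter_upwards [h3.eventually (lt_mem_nhds hi)] with s hs _ using hs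
    · exact Eventually.of_forall fun s h => absurd h hi
  have : (𝓝[Ioo 0 t] t).NeBot := by
    rw [nhdsWithin_Ioo_eq_nhdsLT ht]
    infer_instance
  obtain ⟨s, hs, hmem⟩ := (h2.and self_mem_nhdsWithin).exists
  exact ⟨s, hmem, hs⟩

end IsRelaxation

end Relaxation

/-- Points of the simplex with positive coordinates are relative interior points. -/
lemma mem_intrinsicInterior_stdSimplex {ι : Type*} [Fintype ι] {p : ι → ℝ}
    (hp : p ∈ stdSimplex ℝ ι) (hpos : ∀ i, 0 < p i) :
    p ∈ intrinsicInterior ℝ (stdSimplex ℝ ι) := by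
  rw [mem_intrinsicInterior]
  refine ⟨⟨p, subset_affineSpan ℝ _ hp⟩, ?_, rfl⟩
  rw [mem_interior]
  refine ⟨{y | ∀ i, 0 < (y : ι → ℝ) i}, fun y hy => ⟨fun i => (hy i).le, ?_⟩, ?_, hpos⟩
  · have hy' := y.2
    refine affineSpan_induction (p := fun y : ι → ℝ => ∑ i, y i = 1) hy' (fun z hz => hz.2) ?_
    intro c u v w hu hv hw
    simp only [vsub_eq_sub, vadd_eq_add, Pi.add_apply, Pi.smul_apply, Pi.sub_apply, smul_eq_mul,
      Finset.sum_add_distrib, ← Finset.mul_sum, Finset.sum_sub_distrib, hu, hv, hw]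
    ring
  · simp only [ofPred_forall]
    exact isOpen_iInter_of_finite fun i =>
      isOpen_lt continuous_const ((continuous_apply i).comp continuous_subtype_val)

/-- A weakly decreasing sequence of finite sets cannot decrease strictly too often. -/
lemma exists_eq_succ_of_antitone {α : Type*} [Fintype α] {N : ℕ} (Z : ℕ → Finset α)
    (hZ : ∀ j < N, Z (j + 1) ⊆ Z j) (hne : (Z N).Nonempty) (hcard : Fintype.card α ≤ N) :
    ∃ j < N, Z (j + 1) = Z j := by
  by_contra! hcon
  have h1 : ∀ j ≤ N, (Z j).card + j ≤ Fintype.card α := by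
    intro j
    induction j with
    | zero => exact fun _ => Finset.card_le_univ _
    | succ j ih =>
      intro hj
      have h2 := Finset.card_lt_card ((hZ j hj).ssubset_of_ne (hcon j hj))
      have h3 := ih (Nat.le_of_succ_le hj)
      omega
  have h4 := h1 N le_rfl
  have h5 := hne.card_pos
  omega

/-! ### Entry into the relative interior -/

section Entry

variable {K : ℕ} {ρ : Measure ℝ} {θ : Fin K → ℝ} {b : Fin K} {p : ℝ → Fin K → ℝ}
  {μ : ℝ → Scenario b → ℝ}

namespace IsSolution

lemma ae_deriv_p (hs : IsSolution (payoff ρ θ b) p μ) :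
    ∀ᵐ r : ℝ, 0 ≤ r → ∃ q ∈ LMOp (payoff ρ θ b) (p r, μ r), HasDerivAt p (q - p r) r :=
  (ae_restrict_iff' measurableSet_Ici).1 hs.deriv_p

lemma ae_deriv_mu (hs : IsSolution (payoff ρ θ b) p μ) :
    ∀ᵐ r : ℝ, 0 ≤ r → ∃ ν ∈ LMOmu (payoff ρ θ b) (p r, μ r), HasDerivAt μ (ν - μ r) r :=
  (ae_restrict_iff' measurableSet_Ici).1 hs.deriv_mu

lemma isRelaxation_p (hs : IsSolution (payoff ρ θ b) p μ) : IsRelaxation p :=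
  ⟨hs.ac_p, hs.init_p, hs.ae_deriv_p.mono fun _ hr h0 =>
    let ⟨q, hq, hd⟩ := hr h0
    ⟨q, IsBandit.LMOp_subset_stdSimplex hq, hd⟩⟩

lemma isRelaxation_mu (hs : IsSolution (payoff ρ θ b) p μ) : IsRelaxation μ :=
  ⟨hs.ac_mu, hs.init_mu, hs.ae_deriv_mu.mono fun _ hr h0 =>
    let ⟨ν, hν, hd⟩ := hr h0
    ⟨ν, hν.1, hd⟩⟩

lemma p_mem_orthant (hs : IsSolution (payoff ρ θ b) p μ) {t : ℝ} (ht : 0 ≤ t) :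
    p t ∈ orthant (Fin K) := hs.isRelaxation_p.nonneg ht

/-- The best arm is played immediately. -/
lemma best_pos (h : IsBandit ρ θ b) (hs : IsSolution (payoff ρ θ b) p μ) {t : ℝ} (ht : 0 < t) :
    0 < p t b := by
  have hp := hs.isRelaxation_p
  by_contra hcon
  have hb0 : p t b = 0 := le_antisymm (not_lt.1 hcon) (hp.nonneg ht.le b)
  obtain ⟨s, hst, hpos⟩ := hp.exists_pos_before ht
  obtain ⟨r, hr, hq⟩ := exists_mem_Ioo_of_ae hs.ae_deriv_p hst.2
  have hr0 : 0 ≤ r := (hst.1.trans hr.1).le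
  obtain ⟨q, hq, hd⟩ := hq hr0
  have hzero : ∀ i, p t i = 0 → q i = 0 := fun i hi =>
    target_eq_zero hd hr fun r' hr' =>
      hp.eq_zero_of_eq_zero (hst.1.trans hr'.1).le hr'.2.le hi
  have hall : ∀ i, q i = 0 := by
    intro i
    by_cases hi : p t i = 0
    · exact hzero i hi
    · have hib : i ≠ b := fun hib => hi (hib ▸ hb0)
      have hpi : 0 < p t i := lt_of_le_of_ne (hp.nonneg ht.le i) (Ne.symm hi)
      exact h.apply_eq_zero_of_mem_LMOp (z := (p r, μ r)) (y := ⟨i, hib⟩) (hs.p_mem_orthant hr0)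
        (hp.eq_zero_of_eq_zero hr0 hr.2.le hb0)
        (hp.pos_of_pos hst.1.le hr.1.le (hpos i hpi)).ne' hq
  have hsum := (IsBandit.LMOp_subset_stdSimplex hq).2
  simp [hall] at hsum

end IsSolution

namespace IsBandit

lemma eps0_pos (h : IsBandit ρ θ b) {M : ℝ} (hM : IsGradBound ρ θ b M) : 0 < eps0 ρ θ b M := by
  have h1 := h.isGradBound_pos hM
  have h2 := h.kappaMin_pos
  have h3 : (0 : ℝ) < K := by exact_mod_cast (by have := h.two_le; omega : 0 < K)
  exact lt_min (by norm_num) (by positivity)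

lemma log_one_div_eps0_nonneg (h : IsBandit ρ θ b) {M : ℝ} (hM : IsGradBound ρ θ b M) :
    0 ≤ Real.log (1 / eps0 ρ θ b M) := by
  refine Real.log_nonneg ?_
  rw [le_div_iff₀ (h.eps0_pos hM), one_mul]
  exact (min_le_left _ _).trans (by norm_num)

lemma eps0_mul_le (h : IsBandit ρ θ b) {M : ℝ} (hM : IsGradBound ρ θ b M) :
    K * (eps0 ρ θ b M * M) ≤ kappaMin ρ θ b / 4 := by
  have h1 := h.isGradBound_pos hM
  have h3 : (0 : ℝ) < K := by exact_mod_cast (by have := h.two_le; omega : 0 < K)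
  calc K * (eps0 ρ θ b M * M) ≤ K * (kappaMin ρ θ b / (4 * K * M) * M) := by
        gcongr
        exact min_le_right _ _
    _ = kappaMin ρ θ b / 4 := by field_simp

lemma Tstar_nonneg (h : IsBandit ρ θ b) {M : ℝ} (hM : IsGradBound ρ θ b M) :
    0 ≤ Tstar ρ θ b M := by
  have hK : (2 : ℝ) ≤ K := by exact_mod_cast h.two_le
  have hL0 : 0 ≤ Real.log (1 / eps0 ρ θ b M) := h.log_one_div_eps0_nonneg hM
  have hlog2 : 0 < Real.log 2 := Real.log_pos (by norm_num)
  exact mul_nonneg (by linarith) (by linarith)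

lemma card_scenario (b : Fin K) : Fintype.card (Scenario b) = K - 1 := by
  simp [Scenario]

lemma add_le_one_of_mem_stdSimplex {q : Fin K → ℝ} (hq : q ∈ stdSimplex ℝ (Fin K))
    (x : Scenario b) : q b + q x ≤ 1 := by
  rw [← hq.2, ← Finset.sum_pair (f := q) x.2.symm]
  exact Finset.sum_le_sum_of_subset_of_nonneg (Finset.subset_univ _) fun i _ _ => hq.1 i

/-- If the unplayed scenarios carry all but `eps0` of the weight, one of them is a better
response than every played arm. -/
lemma false_of_unplayed (h : IsBandit ρ θ b) {M : ℝ} (hM : IsGradBound ρ θ b M)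
    {p q : Fin K → ℝ} {μ : Scenario b → ℝ} (hp : p ∈ stdSimplex ℝ (Fin K)) (hpb : p b ≠ 0)
    (hμ : μ ∈ stdSimplex ℝ (Scenario b)) (hq : q ∈ LMOp (payoff ρ θ b) (p, μ))
    (Z : Finset (Scenario b)) (hpZ : ∀ x ∈ Z, p x = 0) (hqZ : ∀ x ∈ Z, q x = 0)
    (hμZ : ∑ x ∈ Zᶜ, μ x ≤ eps0 ρ θ b M) : False := by
  have hpo : p ∈ orthant (Fin K) := hp.1
  have hqs := LMOp_subset_stdSimplex hq
  have hM0 := h.isGradBound_pos hM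
  have hκ := h.kappaMin_pos
  have hε := h.eps0_pos hM
  have hup : q ⬝ᵥ gvec ρ θ b p μ ≤ eps0 ρ θ b M * M := by
    rw [dotProduct_gvec, ← Finset.sum_add_sum_compl Z, Finset.sum_eq_zero (s := Z), zero_add]
    · refine le_trans ?_ (mul_le_mul_of_nonneg_right hμZ hM0.le)
      rw [Finset.sum_mul]
      refine Finset.sum_le_sum fun x _ => mul_le_mul_of_nonneg_left ?_ (hμ.1 x)
      have hsum : p b + p x ≠ 0 :=
        (add_pos_of_pos_of_nonneg (lt_of_le_of_ne (hp.1 b) hpb.symm) (hp.1 x)).ne'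
      obtain ⟨h1, h2⟩ := h.KL_lam_le_of_isGradBound hM hp hsum
      calc q b * KL ρ (θ b) (lam θ b p x) + q x * KL ρ (θ x) (lam θ b p x)
          ≤ q b * M + q x * M :=
            add_le_add (mul_le_mul_of_nonneg_left h1 (hqs.1 b))
              (mul_le_mul_of_nonneg_left h2 (hqs.1 x))
        _ = (q b + q x) * M := by ring
        _ ≤ 1 * M := mul_le_mul_of_nonneg_right (add_le_one_of_mem_stdSimplex hqs x) hM0.le
        _ = M := one_mul M
    · intro x hx
      rw [lam_of_eq_zero_right (hpZ x hx), hqZ x hx, KL_self h.nontrivial (h.mem b)]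
      ring
  have hlow : (1 - eps0 ρ θ b M) * kappaMin ρ θ b ≤ ∑ x ∈ Z, gvec ρ θ b p μ x := by
    have h1 : 1 - eps0 ρ θ b M ≤ ∑ x ∈ Z, μ x := by
      have := Finset.sum_add_sum_compl Z μ
      rw [hμ.2] at this
      linarith
    refine (mul_le_mul_of_nonneg_right h1 hκ.le).trans ?_
    rw [Finset.sum_mul]
    refine Finset.sum_le_sum fun x hx => ?_
    rw [gvec_scenario, lam_of_eq_zero_right (hpZ x hx)]
    refine mul_le_mul_of_nonneg_left ((kappaMin_le x).trans ?_) (hμ.1 x)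
    refine (kappa_le x (right_mem_Icc.2 (h.lt x).le)).trans ?_
    rw [KL_self h.nontrivial (h.mem b), max_eq_left (KL_nonneg _ _)]
  have hmid : ∑ x ∈ Z, gvec ρ θ b p μ x ≤ K * (eps0 ρ θ b M * M) := by
    calc ∑ x ∈ Z, gvec ρ θ b p μ x ≤ ∑ x ∈ Z, eps0 ρ θ b M * M :=
          Finset.sum_le_sum fun x _ =>
            (h.gvec_le_of_mem_LMOp (z := (p, μ)) hpo hpb hq x).trans hup
      _ = Z.card * (eps0 ρ θ b M * M) := by simp
      _ ≤ K * (eps0 ρ θ b M * M) := by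
          have h1 : Z.card ≤ K := (Finset.card_le_univ Z).trans (by rw [card_scenario]; omega)
          have h2 : (Z.card : ℝ) ≤ K := by exact_mod_cast h1
          gcongr
  have h5 := h.eps0_mul_le hM
  have h6 : eps0 ρ θ b M ≤ 1 / 2 := min_le_left _ _
  nlinarith

end IsBandit

namespace IsSolution

/-- A set of unplayed scenarios cannot stay constant for longer than `log (1 / eps0)`. -/
lemma length_le_of_unplayed (h : IsBandit ρ θ b) {M : ℝ} (hM : IsGradBound ρ θ b M)
    (hs : IsSolution (payoff ρ θ b) p μ) {s e : ℝ} (hs0 : 0 ≤ s)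
    {Z : Finset (Scenario b)} (hne : Z.Nonempty) (hzero : ∀ x ∈ Z, p e x = 0)
    (hpos : ∀ x ∉ Z, 0 < p s x) : e - s ≤ Real.log (1 / eps0 ρ θ b M) := by
  by_contra! hlt
  set L := Real.log (1 / eps0 ρ θ b M) with hL
  have hp := hs.isRelaxation_p
  have hmu := hs.isRelaxation_mu
  have hε := h.eps0_pos hM
  have hL0 : 0 ≤ L := h.log_one_div_eps0_nonneg hM
  have hzero' : ∀ x ∈ Z, ∀ r ∈ Ioo s e, p r x = 0 := fun x hx r hr =>
    hp.eq_zero_of_eq_zero (hs0.trans hr.1.le) hr.2.le (hzero x hx)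
  have hν : ∀ᵐ r : ℝ, r ∈ Ioo s e →
      ∃ ν, (∀ x ∉ Z, ν x = 0) ∧ HasDerivAt μ (ν - μ r) r := by
    filter_upwards [hs.ae_deriv_mu] with r hr hmem
    have hr0 : 0 < r := hs0.trans_lt hmem.1
    obtain ⟨ν, hν, hd⟩ := hr hr0.le
    refine ⟨ν, fun x hx => ?_, hd⟩
    obtain ⟨x₀, hx₀⟩ := hne
    have hpo := hs.p_mem_orthant hr0.le
    have h1 := IsBandit.dotProduct_D_le_of_mem_LMOmu hν x₀
    rw [h.D_of_eq_zero_right hpo (hzero' x₀ hx₀ r hmem)] at h1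
    have h2 : ∀ y ∈ Finset.univ, 0 ≤ ν y * D ρ θ b (p r) y := fun y _ =>
      mul_nonneg (hν.1.1 y) (h.D_nonneg hpo y)
    have h3 := (Finset.sum_eq_zero_iff_of_nonneg h2).1
      (le_antisymm h1 (Finset.sum_nonneg h2)) x (Finset.mem_univ x)
    exact (mul_eq_zero.1 h3).resolve_right
      (h.D_pos hpo x (hs.best_pos h hr0) (hp.pos_of_pos hs0 hmem.1.le (hpos x hx))).ne'
  obtain ⟨r, hr, hq⟩ := exists_mem_Ioo_of_ae hs.ae_deriv_p (by linarith : s + L < e)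
  have hsr : s ≤ r := by linarith [hr.1]
  have hr0 : 0 ≤ r := hs0.trans hsr
  obtain ⟨q, hq, hd⟩ := hq hr0
  have hdecay : ∑ x ∈ Zᶜ, μ r x ≤ Real.exp (-(r - s)) * ∑ x ∈ Zᶜ, μ s x := by
    refine le_exp_mul_of_deriv_le (w := fun r => ∑ x ∈ Zᶜ, μ r x) hsr
      (AbsolutelyContinuousOnInterval.finset_sum fun x _ => (hmu.ac_Icc hs0 hsr).apply x) ?_
    filter_upwards [hν] with r' hr' hmem
    obtain ⟨ν, hν0, hd'⟩ := hr' ⟨hmem.1, hmem.2.trans hr.2⟩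
    refine ⟨_, HasDerivAt.fun_sum fun x _ => hasDerivAt_pi.1 hd' x, le_of_eq ?_⟩
    rw [← Finset.sum_neg_distrib]
    refine Finset.sum_congr rfl fun x hx => ?_
    rw [Pi.sub_apply, hν0 x (Finset.mem_compl.1 hx), zero_sub]
  have hsum1 : ∑ x ∈ Zᶜ, μ s x ≤ 1 := by
    rw [← hmu.sum_eq_one hs0]
    exact Finset.sum_le_sum_of_subset_of_nonneg (Finset.subset_univ _)
      fun x _ _ => hmu.nonneg hs0 x
  have hexp : Real.exp (-(r - s)) ≤ eps0 ρ θ b M := by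
    calc Real.exp (-(r - s)) ≤ Real.exp (-L) := Real.exp_le_exp.2 (by linarith [hr.1])
      _ = eps0 ρ θ b M := by
        rw [hL, one_div, Real.log_inv, neg_neg, Real.exp_log hε]
  refine h.false_of_unplayed hM (hp.mem_stdSimplex hr0)
    (hs.best_pos h (by linarith [hr.1] : 0 < r)).ne'
    (hmu.mem_stdSimplex hr0) hq Z
    (fun x hx => hzero' x hx r ⟨by linarith [hr.1], hr.2⟩)
    (fun x hx => target_eq_zero hd (s := s) (t := e) ⟨by linarith [hr.1], hr.2⟩ (hzero' x hx)) ?_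
  calc ∑ x ∈ Zᶜ, μ r x ≤ Real.exp (-(r - s)) * ∑ x ∈ Zᶜ, μ s x := hdecay
    _ ≤ Real.exp (-(r - s)) * 1 := by gcongr
    _ ≤ eps0 ρ θ b M := by rwa [mul_one]

lemma scenario_pos (h : IsBandit ρ θ b) {M : ℝ} (hM : IsGradBound ρ θ b M)
    (hs : IsSolution (payoff ρ θ b) p μ) {t : ℝ} (ht : Tstar ρ θ b M < t) (x : Scenario b) :
    0 < p t x := by
  have hp := hs.isRelaxation_p
  have hK := h.two_le
  obtain ⟨N, rfl⟩ : ∃ N, K = N + 1 := ⟨K - 1, by omega⟩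
  have hN : (0 : ℝ) < N := by exact_mod_cast (by omega : 0 < N)
  set L := Real.log (1 / eps0 ρ θ b M) with hL
  have hL0 : 0 ≤ L := h.log_one_div_eps0_nonneg hM
  have hlog2 : 0 < Real.log 2 := Real.log_pos (by norm_num)
  have hT : Tstar ρ θ b M = N * (L + Real.log 2) := by
    simp [Tstar, hL]
  have ht0 : 0 < t := by
    have : 0 < N * (L + Real.log 2) := by positivity
    linarith
  have hdt : L < t / N := by
    rw [lt_div_iff₀ hN]
    nlinarith
  have hdt0 : 0 ≤ t / N := by positivity
  by_contra hcon
  have hx0 : p t x = 0 := le_antisymm (not_lt.1 hcon) (hp.nonneg ht0.le x)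
  set τ : ℕ → ℝ := fun j => j * (t / N) with hτ
  have hτ0 : ∀ j, 0 ≤ τ j := fun j => by positivity
  have hτs : ∀ j, τ (j + 1) = τ j + t / N := fun j => by
    simp only [hτ]
    push_cast
    ring
  have hτN : τ N = t := by
    simp only [hτ]
    field_simp
  have hτle : ∀ j ≤ N, τ j ≤ t := fun j hj => by
    rw [← hτN]
    simp only [hτ]
    gcongr
  set Z : ℕ → Finset (Scenario b) := fun j => Finset.univ.filter fun y => p (τ j) y = 0 with hZ
  have hmem : ∀ j ≤ N, x ∈ Z j := fun j hj => by
    simpa [hZ] using hp.eq_zero_of_eq_zero (hτ0 j) (hτle j hj) hx0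
  obtain ⟨j, hj, hjeq⟩ := exists_eq_succ_of_antitone Z
    (fun j _ y hy => by
      simp only [hZ, Finset.mem_filter, Finset.mem_univ, true_and] at hy ⊢
      exact hp.eq_zero_of_eq_zero (hτ0 j) (by rw [hτs]; linarith) hy)
    ⟨x, hmem N le_rfl⟩ (by rw [IsBandit.card_scenario]; omega)
  have hlen := hs.length_le_of_unplayed h hM (hτ0 j) (e := τ (j + 1)) (Z := Z j) ⟨x, hmem j hj.le⟩
    (fun y hy => by
      rw [← hjeq] at hy
      simpa [hZ] using hy)
    (fun y hy => lt_of_le_of_ne (hp.nonneg (hτ0 j) y) fun h0 => hy (by simp [hZ, ← h0]))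
  rw [hτs] at hlen
  linarith

/-- After the entry time all arms have positive weight. -/
lemma pos_of_Tstar_lt (h : IsBandit ρ θ b) {M : ℝ} (hM : IsGradBound ρ θ b M)
    (hs : IsSolution (payoff ρ θ b) p μ) {t : ℝ} (ht : Tstar ρ θ b M < t) (i : Fin K) :
    0 < p t i := by
  by_cases hi : i = b
  · rw [hi]
    exact hs.best_pos h ((h.Tstar_nonneg hM).trans_lt ht)
  · exact hs.scenario_pos h hM ht ⟨i, hi⟩

end IsSolution

end Entry

/-! ### Equilibria and convergence of the game value -/

section Value

lemma dotProduct_le_of_forall_le {ι : Type*} [Fintype ι] {q f : ι → ℝ} {c : ℝ}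
    (hq : q ∈ stdSimplex ℝ ι) (hf : ∀ i, f i ≤ c) : q ⬝ᵥ f ≤ c := by
  calc q ⬝ᵥ f ≤ ∑ i, q i * c :=
        Finset.sum_le_sum fun i _ => mul_le_mul_of_nonneg_left (hf i) (hq.1 i)
    _ = c := by rw [← Finset.sum_mul, hq.2, one_mul]

lemma le_dotProduct_of_forall_le {ι : Type*} [Fintype ι] {q f : ι → ℝ} {c : ℝ}
    (hq : q ∈ stdSimplex ℝ ι) (hf : ∀ i, c ≤ f i) : c ≤ q ⬝ᵥ f := by
  calc c = ∑ i, q i * c := by rw [← Finset.sum_mul, hq.2, one_mul]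
    _ ≤ q ⬝ᵥ f := Finset.sum_le_sum fun i _ => mul_le_mul_of_nonneg_left (hf i) (hq.1 i)

lemma _root_.AbsolutelyContinuousOnInterval.congr_uIcc {X : Type*} [PseudoMetricSpace X]
    {f g : ℝ → X} {s t : ℝ} (hf : AbsolutelyContinuousOnInterval f s t)
    (hfg : EqOn f g (uIcc s t)) : AbsolutelyContinuousOnInterval g s t := by
  rw [absolutelyContinuousOnInterval_iff] at hf ⊢
  intro ε hε
  obtain ⟨δ, hδ, h⟩ := hf ε hε
  refine ⟨δ, hδ, fun E hE hlen => lt_of_eq_of_lt ?_ (h E hE hlen)⟩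
  exact Finset.sum_congr rfl fun i hi => by
    rw [hfg (hE.1 i hi).1, hfg (hE.1 i hi).2]

variable {K : ℕ} {ρ : Measure ℝ} {θ : Fin K → ℝ} {b : Fin K} {p : ℝ → Fin K → ℝ}
  {μ : ℝ → Scenario b → ℝ}

/-- The duality gap: the largest difference between a response value of the first player and a
response value of the second. -/
def gap (ρ : Measure ℝ) (θ : Fin K → ℝ) (b : Fin K) [Nonempty (Fin K × Scenario b)]
    (p : Fin K → ℝ) (μ : Scenario b → ℝ) : ℝ :=
  Finset.univ.sup' Finset.univ_nonempty
    fun ix : Fin K × Scenario b => gvec ρ θ b p μ ix.1 - D ρ θ b p ix.2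

namespace IsBandit

lemma dotProduct_sub_le_gap [Nonempty (Fin K × Scenario b)] {q p : Fin K → ℝ}
    {ν μ : Scenario b → ℝ} (hq : q ∈ stdSimplex ℝ (Fin K)) (hν : ν ∈ stdSimplex ℝ (Scenario b)) :
    q ⬝ᵥ gvec ρ θ b p μ - ν ⬝ᵥ D ρ θ b p ≤ gap ρ θ b p μ := by
  have h1 : ∀ i x, gvec ρ θ b p μ i - D ρ θ b p x ≤ gap ρ θ b p μ := fun i x =>
    Finset.le_sup' (f := fun ix : Fin K × Scenario b => gvec ρ θ b p μ ix.1 - D ρ θ b p ix.2)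
      (Finset.mem_univ (i, x))
  have h2 : ∀ x, q ⬝ᵥ gvec ρ θ b p μ ≤ gap ρ θ b p μ + D ρ θ b p x := fun x =>
    dotProduct_le_of_forall_le hq fun i => by linarith [h1 i x]
  have h3 : q ⬝ᵥ gvec ρ θ b p μ - gap ρ θ b p μ ≤ ν ⬝ᵥ D ρ θ b p :=
    le_dotProduct_of_forall_le hν fun x => by linarith [h2 x]
  linarith

lemma gap_eq_of_best_response [Nonempty (Fin K × Scenario b)] {q p : Fin K → ℝ}
    {ν μ : Scenario b → ℝ} (hq : q ∈ stdSimplex ℝ (Fin K)) (hν : ν ∈ stdSimplex ℝ (Scenario b))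
    (hqmax : ∀ i, gvec ρ θ b p μ i ≤ q ⬝ᵥ gvec ρ θ b p μ)
    (hνmin : ∀ x, ν ⬝ᵥ D ρ θ b p ≤ D ρ θ b p x) :
    gap ρ θ b p μ = q ⬝ᵥ gvec ρ θ b p μ - ν ⬝ᵥ D ρ θ b p :=
  le_antisymm (Finset.sup'_le _ _ fun ix _ => sub_le_sub (hqmax ix.1) (hνmin ix.2))
    (dotProduct_sub_le_gap hq hν)

lemma gap_le_klBound [Nonempty (Fin K × Scenario b)] (h : IsBandit ρ θ b) {p : Fin K → ℝ}
    {μ : Scenario b → ℝ} (hp : p ∈ orthant (Fin K)) (hμ : μ ∈ stdSimplex ℝ (Scenario b)) :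
    gap ρ θ b p μ ≤ klBound ρ θ b := by
  refine Finset.sup'_le _ _ fun ix _ => ?_
  have h1 : gvec ρ θ b p μ ix.1 ≤ klBound ρ θ b := by
    refine dotProduct_le_of_forall_le hμ fun x => ?_
    have := (le_abs_self _).trans (h.abs_derivD_single_le hp x ix.1)
    rwa [derivD_apply] at this
  have := h.D_nonneg hp ix.2
  linarith

/-- The payoff is bounded by its linearizations. -/
lemma payoff_le_dotProduct (h : IsBandit ρ θ b) {p p' : Fin K → ℝ} {μ : Scenario b → ℝ}
    (hp : p ∈ orthant (Fin K)) (hp' : p' ∈ orthant (Fin K)) (hμ : ∀ x, 0 ≤ μ x) :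
    payoff ρ θ b (p', μ) ≤ p' ⬝ᵥ gvec ρ θ b p μ := by
  rw [dotProduct_gvec]
  exact Finset.sum_le_sum fun x _ =>
    mul_le_mul_of_nonneg_left (h.D_le hp' x (h.lam_mem hp x)) (hμ x)

lemma concaveOn_payoff (h : IsBandit ρ θ b) {μ : Scenario b → ℝ} (hμ : ∀ x, 0 ≤ μ x) :
    ConcaveOn ℝ (stdSimplex ℝ (Fin K)) fun p => payoff ρ θ b (p, μ) := by
  refine ⟨convex_stdSimplex ℝ _, fun p hp p' hp' s t hs ht hst => ?_⟩
  have hmem := convex_stdSimplex ℝ (Fin K) hp hp' hs ht hst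
  have hmem' : s • p + t • p' ∈ orthant (Fin K) := hmem.1
  simp only [smul_eq_mul]
  rw [h.payoff_eq_dotProduct hmem', add_dotProduct, smul_dotProduct, smul_dotProduct]
  exact add_le_add
    (mul_le_mul_of_nonneg_left (h.payoff_le_dotProduct hmem' hp.1 hμ) hs)
    (mul_le_mul_of_nonneg_left (h.payoff_le_dotProduct hmem' hp'.1 hμ) ht)

lemma upperSemicontinuousOn_payoff (h : IsBandit ρ θ b) {μ : Scenario b → ℝ}
    (hμ : ∀ x, 0 ≤ μ x) :
    UpperSemicontinuousOn (fun p => payoff ρ θ b (p, μ)) (stdSimplex ℝ (Fin K)) := by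
  intro p hp c hc
  have hpo : p ∈ orthant (Fin K) := hp.1
  change payoff ρ θ b (p, μ) < c at hc
  rw [h.payoff_eq_dotProduct hpo] at hc
  have hcont : Continuous fun p' : Fin K → ℝ => p' ⬝ᵥ gvec ρ θ b p μ := by
    unfold dotProduct
    fun_prop
  filter_upwards [nhdsWithin_le_nhds (hcont.continuousAt.eventually (gt_mem_nhds hc)),
    self_mem_nhdsWithin] with p' h1 h2
  exact (h.payoff_le_dotProduct hpo h2.1 hμ).trans_lt h1

lemma exists_isNash (h : IsBandit ρ θ b) :
    ∃ (ps : Fin K → ℝ) (μs : Scenario b → ℝ), IsNash (payoff ρ θ b) ps μs := by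
  have := h.nonempty
  have hK : Nonempty (Fin K) := ⟨b⟩
  have hlin : ∀ p : Fin K → ℝ, IsLinearMap ℝ fun μ : Scenario b → ℝ => payoff ρ θ b (p, μ) :=
    fun p => ⟨fun μ ν => by simp [payoff, add_mul, Finset.sum_add_distrib],
      fun c μ => by simp [payoff, Finset.mul_sum, mul_assoc]⟩
  obtain ⟨μs, hμs, ps, hps, hsaddle⟩ := Sion.exists_isSaddlePointOn
    (X := stdSimplex ℝ (Scenario b)) (Y := stdSimplex ℝ (Fin K))
    (f := fun μ p => payoff ρ θ b (p, μ))
    ⟨_, single_mem_stdSimplex ℝ (Classical.arbitrary (Scenario b))⟩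
    (convex_stdSimplex ℝ _) (isCompact_stdSimplex ℝ _)
    (fun p _ => by
      have hcont : Continuous fun μ : Scenario b → ℝ => payoff ρ θ b (p, μ) := by
        simp only [payoff]
        fun_prop
      exact hcont.lowerSemicontinuous.lowerSemicontinuousOn _)
    (fun p _ => (((hlin p).mk' _).convexOn (convex_stdSimplex ℝ _)).quasiconvexOn)
    (convex_stdSimplex ℝ _) ⟨_, single_mem_stdSimplex ℝ b⟩ (isCompact_stdSimplex ℝ _)
    (fun μ hμ => h.upperSemicontinuousOn_payoff hμ.1)
    (fun μ hμ => (h.concaveOn_payoff hμ.1).quasiconcaveOn)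
  exact ⟨ps, μs, hps, hμs, fun p hp => hsaddle μs hμs p hp, fun μ hμ => hsaddle μ hμ ps hps⟩

/-- The distance to the value of the game is at most the duality gap. -/
lemma abs_payoff_sub_le_gap [Nonempty (Fin K × Scenario b)] (h : IsBandit ρ θ b)
    {p ps : Fin K → ℝ} {μ μs : Scenario b → ℝ} (hn : IsNash (payoff ρ θ b) ps μs)
    (hp : p ∈ stdSimplex ℝ (Fin K)) (hμ : μ ∈ stdSimplex ℝ (Scenario b)) :
    |payoff ρ θ b (p, μ) - payoff ρ θ b (ps, μs)| ≤ gap ρ θ b p μ := by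
  obtain ⟨hps, hμs, h1, h2⟩ := hn
  have e1 := h.payoff_eq_dotProduct hp.1 μ
  have e2 : payoff ρ θ b (p, μ) = μ ⬝ᵥ D ρ θ b p := rfl
  have e3 : payoff ρ θ b (p, μs) = μs ⬝ᵥ D ρ θ b p := rfl
  have h3 := h1 p hp
  have h4 := (h2 μ hμ).trans (h.payoff_le_dotProduct hp.1 hps.1 hμ.1)
  have h5 := dotProduct_sub_le_gap (ρ := ρ) (θ := θ) (p := p) (μ := μ) hp hμs
  have h6 := dotProduct_sub_le_gap (ρ := ρ) (θ := θ) (p := p) (μ := μ) hps hμ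
  rw [abs_le]
  constructor <;> linarith

end IsBandit

namespace IsSolution

lemma hasDerivAt_lam (h : IsBandit ρ θ b) (hs : IsSolution (payoff ρ θ b) p μ) {r : ℝ}
    (hr : 0 < r) {q : Fin K → ℝ} (hd : HasDerivAt p (q - p r) r) (x : Scenario b) :
    HasDerivAt (fun r => lam θ b (p r) x)
      ((q b * (θ b - lam θ b (p r) x) + q x * (θ x - lam θ b (p r) x)) / (p r b + p r x)) r := by
  have hpos : ∀ r, 0 < r → p r b + p r x ≠ 0 := fun r hr =>
    (add_pos_of_pos_of_nonneg (hs.best_pos h hr) (hs.p_mem_orthant hr.le x)).ne'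
  have hb := hasDerivAt_pi.1 hd b
  have hx := hasDerivAt_pi.1 hd x
  have h1 := ((hb.mul_const (θ b)).fun_add (hx.mul_const (θ x))).fun_div (hb.fun_add hx)
    (hpos r hr)
  have hlam : lam θ b (p r) x = (p r b * θ b + p r x * θ x) / (p r b + p r x) := by
    simp [lam, hpos r hr]
  refine (h1.congr_of_eventuallyEq ?_).congr_deriv ?_
  · filter_upwards [lt_mem_nhds hr] with r' hr'
    simp [lam, hpos r' hr']
  · rw [hlam]
    have := hpos r hr
    simp only [Pi.sub_apply]
    field_simp
    ring

lemma hasDerivAt_KL_lam (h : IsBandit ρ θ b) (hs : IsSolution (payoff ρ θ b) p μ) {r : ℝ}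
    (hr : 0 < r) {q : Fin K → ℝ} (hd : HasDerivAt p (q - p r) r) (x : Scenario b) (i : Fin K) :
    HasDerivAt (fun r => KL ρ (θ i) (lam θ b (p r) x))
      ((lam θ b (p r) x - θ i) * natOfDeriv ρ (lam θ b (p r) x)
        * ((q b * (θ b - lam θ b (p r) x) + q x * (θ x - lam θ b (p r) x))
          / (p r b + p r x))) r :=
  HasDerivAt.comp (h₂ := KL ρ (θ i)) r (hasDerivAt_KL h.nontrivial (h.mem i)
    (h.lam_mem_meanSpace (hs.p_mem_orthant hr.le) x)) (hs.hasDerivAt_lam h hr hd x)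

/-- The scenario payoff along a solution. -/
lemma hasDerivAt_D (h : IsBandit ρ θ b) (hs : IsSolution (payoff ρ θ b) p μ) {r : ℝ}
    (hr : 0 < r) {q : Fin K → ℝ} (hd : HasDerivAt p (q - p r) r) (x : Scenario b) :
    HasDerivAt (fun r => D ρ θ b (p r) x)
      (q b * KL ρ (θ b) (lam θ b (p r) x) + q x * KL ρ (θ x) (lam θ b (p r) x)
        - D ρ θ b (p r) x) r := by
  have h1 := ((hasDerivAt_pi.1 hd b).fun_mul (hs.hasDerivAt_KL_lam h hr hd x b)).fun_add
    ((hasDerivAt_pi.1 hd x).fun_mul (hs.hasDerivAt_KL_lam h hr hd x x))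
  refine (h1.congr_of_eventuallyEq ?_).congr_deriv ?_
  · filter_upwards [lt_mem_nhds hr] with r' hr'
    exact h.D_eq (hs.p_mem_orthant hr'.le) x
  · rw [h.D_eq (hs.p_mem_orthant hr.le) x]
    have hlam := IsBandit.sum_mul_lam (θ := θ) (hs.p_mem_orthant hr.le) x
    simp only [Pi.sub_apply]
    linear_combination natOfDeriv ρ (lam θ b (p r) x)
      * ((q b * (θ b - lam θ b (p r) x) + q x * (θ x - lam θ b (p r) x))
          / (p r b + p r x)) * hlam

/-- The response value of a fixed strategy along a solution. -/
lemma exists_hasDerivAt_dotProduct_gvec (h : IsBandit ρ θ b)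
    (hs : IsSolution (payoff ρ θ b) p μ) {r : ℝ} (hr : 0 < r) {q : Fin K → ℝ}
    {ν : Scenario b → ℝ} (hd : HasDerivAt p (q - p r) r) (hd' : HasDerivAt μ (ν - μ r) r) :
    ∃ c, HasDerivAt (fun r => q ⬝ᵥ gvec ρ θ b (p r) (μ r)) c r ∧
      c ≤ ∑ x, (ν x - μ r x) * (q b * KL ρ (θ b) (lam θ b (p r) x)
        + q x * KL ρ (θ x) (lam θ b (p r) x)) := by
  simp_rw [IsBandit.dotProduct_gvec]
  refine ⟨_, HasDerivAt.fun_sum fun x _ => (hasDerivAt_pi.1 hd' x).fun_mul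
    (((hs.hasDerivAt_KL_lam h hr hd x b).const_mul (q b)).fun_add
      ((hs.hasDerivAt_KL_lam h hr hd x x).const_mul (q x))), Finset.sum_le_sum fun x _ => ?_⟩
  have hpo := hs.p_mem_orthant hr.le
  have hv := natOfDeriv_pos h.nontrivial (h.lam_mem_meanSpace hpo x)
  have hμ := hs.isRelaxation_mu.nonneg hr.le x
  have hS : 0 < p r b + p r x := add_pos_of_pos_of_nonneg (hs.best_pos h hr) (hpo x)
  simp only [Pi.sub_apply]
  set l := lam θ b (p r) x
  set v := natOfDeriv ρ l
  have hsq : 0 ≤ μ r x * (v * ((q b * (θ b - l) + q x * (θ x - l)) ^ 2 / (p r b + p r x))) := by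
    positivity
  have heq : μ r x * (q b * ((l - θ b) * v
        * ((q b * (θ b - l) + q x * (θ x - l)) / (p r b + p r x)))
      + q x * ((l - θ x) * v * ((q b * (θ b - l) + q x * (θ x - l)) / (p r b + p r x))))
      = -(μ r x * (v * ((q b * (θ b - l) + q x * (θ x - l)) ^ 2 / (p r b + p r x)))) := by
    ring
  linarith

lemma ac_KL_lam (h : IsBandit ρ θ b) (hs : IsSolution (payoff ρ θ b) p μ) {s t : ℝ}
    (hs0 : 0 < s) (hst : s ≤ t) (x : Scenario b) (i : Fin K) :
    AbsolutelyContinuousOnInterval (fun r => KL ρ (θ i) (lam θ b (p r) x)) s t := by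
  have hp := hs.isRelaxation_p
  have hac := hp.ac_Icc hs0.le hst
  have hnn : ∀ r ∈ uIcc s t, s ≤ r ∧ 0 ≤ r := fun r hr => by
    rw [uIcc_of_le hst] at hr
    exact ⟨hr.1, hs0.le.trans hr.1⟩
  set δ := Real.exp (-(t - s)) * p s b with hδ
  have hδ0 : 0 < δ := mul_pos (Real.exp_pos _) (hs.best_pos h hs0)
  have hS : ∀ r ∈ uIcc s t, p r b + p r x ∈ Icc δ 1 := by
    intro r hr
    obtain ⟨h1, h2⟩ := hnn r hr
    refine ⟨?_, IsBandit.add_le_one_of_mem_stdSimplex (hp.mem_stdSimplex h2) x⟩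
    have h3 : δ ≤ Real.exp (-(r - s)) * p s b := by
      rw [uIcc_of_le hst] at hr
      exact mul_le_mul_of_nonneg_right (Real.exp_le_exp.2 (by linarith [hr.2]))
        (hs.best_pos h hs0).le
    linarith [hp.exp_mul_le hs0.le h1 b, hp.nonneg h2 x]
  have hinv : AbsolutelyContinuousOnInterval (fun r => (p r b + p r x)⁻¹) s t := by
    have hcd : ContDiffOn ℝ 1 (fun y : ℝ => y⁻¹) (Icc δ 1) :=
      (contDiffOn_inv ℝ).mono fun y hy => (hδ0.trans_le hy.1).ne'
    obtain ⟨C, hC⟩ := hcd.exists_lipschitzOnWith (by decide) (convex_Icc _ _) isCompact_Icc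
    exact ((hac.apply b).add (hac.apply x)).lipschitz_comp hC hS
  have hlam : AbsolutelyContinuousOnInterval (fun r => lam θ b (p r) x) s t := by
    refine ((((hac.apply b).const_mul (θ b)).add
      ((hac.apply x).const_mul (θ x))).fun_mul hinv).congr_uIcc fun r hr => ?_
    have : p r b + p r x ≠ 0 := (hδ0.trans_le (hS r hr).1).ne'
    simp only [lam, this, if_false, Pi.add_apply]
    ring
  obtain ⟨C, hC⟩ := lipschitzOnWith_KL h.nontrivial (h.mem i) (h.mem x) (h.mem b)
  exact hlam.lipschitz_comp hC fun r hr => h.lam_mem (hs.p_mem_orthant (hnn r hr).2) x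

lemma ac_gap [Nonempty (Fin K × Scenario b)] (h : IsBandit ρ θ b)
    (hs : IsSolution (payoff ρ θ b) p μ) {s t : ℝ} (hs0 : 0 < s) (hst : s ≤ t) :
    AbsolutelyContinuousOnInterval (fun r => gap ρ θ b (p r) (μ r)) s t := by
  have hac := hs.isRelaxation_p.ac_Icc hs0.le hst
  have hac' := hs.isRelaxation_mu.ac_Icc hs0.le hst
  have hk := fun x i => hs.ac_KL_lam h hs0 hst x i
  have hD : ∀ x, AbsolutelyContinuousOnInterval (fun r => D ρ θ b (p r) x) s t := fun x => by
    refine (((hac.apply b).fun_mul (hk x b)).add ((hac.apply x).fun_mul (hk x x))).congr_uIcc ?_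
    intro r hr
    rw [uIcc_of_le hst] at hr
    exact (h.D_eq (hs.p_mem_orthant (hs0.le.trans hr.1)) x).symm
  have hg : ∀ i, AbsolutelyContinuousOnInterval (fun r => gvec ρ θ b (p r) (μ r) i) s t :=
    fun i => AbsolutelyContinuousOnInterval.finset_sum fun x _ =>
      (hac'.apply x).fun_mul (((hk x b).const_mul _).add ((hk x x).const_mul _))
  have hsup := Finset.sup'_induction (p := fun f : ℝ → ℝ => AbsolutelyContinuousOnInterval f s t)
    (Finset.univ_nonempty (α := Fin K × Scenario b))
    (fun ix r => gvec ρ θ b (p r) (μ r) ix.1 - D ρ θ b (p r) ix.2)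
    (fun _ hf _ hg => hf.sup hg) fun ix _ => (hg ix.1).sub (hD ix.2)
  refine hsup.congr_uIcc fun r _ => ?_
  simp [gap, Finset.sup'_apply]

/-- The duality gap decreases at unit relative rate. -/
lemma ae_deriv_gap_le [Nonempty (Fin K × Scenario b)] (h : IsBandit ρ θ b)
    (hs : IsSolution (payoff ρ θ b) p μ) {s t : ℝ} (hs0 : 0 < s) (hst : s ≤ t) :
    ∀ᵐ r, r ∈ Ioo s t → ∃ w', HasDerivAt (fun r => gap ρ θ b (p r) (μ r)) w' r ∧
      w' ≤ -gap ρ θ b (p r) (μ r) := by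
  filter_upwards [(hs.ac_gap h hs0 hst).ae_differentiableAt, hs.ae_deriv_p, hs.ae_deriv_mu]
    with r hdiff hrp hrμ hmem
  have hr : 0 < r := hs0.trans hmem.1
  have hV := (hdiff (by rw [uIcc_of_le hst]; exact Ioo_subset_Icc_self hmem)).hasDerivAt
  obtain ⟨q, hq, hd⟩ := hrp hr.le
  obtain ⟨ν, hν, hd'⟩ := hrμ hr.le
  have hqs := IsBandit.LMOp_subset_stdSimplex hq
  refine ⟨_, hV, ?_⟩
  obtain ⟨c, hc, hcle⟩ := hs.exists_hasDerivAt_dotProduct_gvec h hr hd hd'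
  have hDd : HasDerivAt (fun r => ν ⬝ᵥ D ρ θ b (p r))
      (∑ x, ν x * (q b * KL ρ (θ b) (lam θ b (p r) x) + q x * KL ρ (θ x) (lam θ b (p r) x)
        - D ρ θ b (p r) x)) r :=
    HasDerivAt.fun_sum fun x _ => (hs.hasDerivAt_D h hr hd x).const_mul (ν x)
  have hgap := IsBandit.gap_eq_of_best_response hqs hν.1
    (h.gvec_le_of_mem_LMOp (z := (p r, μ r)) (hs.p_mem_orthant hr.le) (hs.best_pos h hr).ne' hq)
    (IsBandit.dotProduct_D_le_of_mem_LMOmu hν)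
  have hmin : IsLocalMin (fun r' => gap ρ θ b (p r') (μ r')
      - (q ⬝ᵥ gvec ρ θ b (p r') (μ r') - ν ⬝ᵥ D ρ θ b (p r'))) r := by
    refine Eventually.of_forall fun r' => ?_
    simp only [hgap, sub_self]
    exact sub_nonneg.2 (IsBandit.dotProduct_sub_le_gap hqs hν.1)
  have hzero := hmin.hasDerivAt_eq_zero (hV.fun_sub (hc.fun_sub hDd))
  rw [hgap, IsBandit.dotProduct_gvec]
  have e1 : ∑ x, (ν x - μ r x) * (q b * KL ρ (θ b) (lam θ b (p r) x)
        + q x * KL ρ (θ x) (lam θ b (p r) x))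
      - ∑ x, ν x * (q b * KL ρ (θ b) (lam θ b (p r) x) + q x * KL ρ (θ x) (lam θ b (p r) x)
        - D ρ θ b (p r) x)
      = -(∑ x, μ r x * (q b * KL ρ (θ b) (lam θ b (p r) x)
        + q x * KL ρ (θ x) (lam θ b (p r) x)) - ν ⬝ᵥ D ρ θ b (p r)) := by
    simp only [dotProduct]
    rw [← Finset.sum_sub_distrib, ← Finset.sum_sub_distrib, ← Finset.sum_neg_distrib]
    exact Finset.sum_congr rfl fun x _ => by ring
  linarith

/-- The value of the game is approached at an exponential rate. -/
lemma abs_payoff_sub_le (h : IsBandit ρ θ b) (hs : IsSolution (payoff ρ θ b) p μ)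
    {ps : Fin K → ℝ} {μs : Scenario b → ℝ} (hn : IsNash (payoff ρ θ b) ps μs) {t : ℝ}
    (ht : 1 ≤ t) :
    |payoff ρ θ b (p t, μ t) - payoff ρ θ b (ps, μs)|
      ≤ Real.exp (-(t - 1)) * IsBandit.klBound ρ θ b := by
  obtain ⟨x⟩ := h.nonempty
  have : Nonempty (Fin K × Scenario b) := ⟨(b, x)⟩
  have ht0 : (0 : ℝ) ≤ t := zero_le_one.trans ht
  calc |payoff ρ θ b (p t, μ t) - payoff ρ θ b (ps, μs)|
      ≤ gap ρ θ b (p t) (μ t) :=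
        h.abs_payoff_sub_le_gap hn (hs.isRelaxation_p.mem_stdSimplex ht0)
          (hs.isRelaxation_mu.mem_stdSimplex ht0)
    _ ≤ Real.exp (-(t - 1)) * gap ρ θ b (p 1) (μ 1) :=
        le_exp_mul_of_deriv_le ht (hs.ac_gap h one_pos ht) (hs.ae_deriv_gap_le h one_pos ht)
    _ ≤ Real.exp (-(t - 1)) * IsBandit.klBound ρ θ b := by
        gcongr
        exact h.gap_le_klBound (hs.p_mem_orthant zero_le_one)
          (hs.isRelaxation_mu.mem_stdSimplex zero_le_one)

end IsSolution

end Value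

end FWSP

end

theorem theorem4 {K : ℕ} (hK : 2 ≤ K) (ρ : MeasureTheory.Measure ℝ) (θ : Fin K → ℝ)
    (hθ : ∀ i, θ i ∈ FWSP.meanSpace ρ) (b : Fin K) (hb : ∀ x, x ≠ b → θ x < θ b) :
    (∃ M : ℝ, FWSP.IsGradBound ρ θ b M) ∧
    (∀ M : ℝ, FWSP.IsGradBound ρ θ b M →
      ∀ (p : ℝ → Fin K → ℝ) (μ : ℝ → FWSP.Scenario b → ℝ),
        FWSP.IsSolution (FWSP.payoff ρ θ b) p μ →
        ∀ t : ℝ, FWSP.Tstar ρ θ b M < t →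
          p t ∈ intrinsicInterior ℝ (stdSimplex ℝ (Fin K)) ∧
          DifferentiableAt ℝ (FWSP.payoff ρ θ b) (p t, μ t)) ∧
    ∃ (ps : Fin K → ℝ) (μs : FWSP.Scenario b → ℝ),
      FWSP.IsNash (FWSP.payoff ρ θ b) ps μs ∧
      ∀ ε : ℝ, 0 < ε → ∃ T : ℝ,
        ∀ (p : ℝ → Fin K → ℝ) (μ : ℝ → FWSP.Scenario b → ℝ),
          FWSP.IsSolution (FWSP.payoff ρ θ b) p μ →
          ∀ t : ℝ, T ≤ t →
            |FWSP.payoff ρ θ b (p t, μ t) - FWSP.payoff ρ θ b (ps, μs)| ≤ ε := by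
  have h : FWSP.IsBandit ρ θ b := ⟨hK, hθ, fun x => hb x x.2⟩
  refine ⟨h.exists_isGradBound, fun M hM p μ hs t ht => ?_, ?_⟩
  · have hpos := hs.pos_of_Tstar_lt h hM ht
    have ht0 : 0 ≤ t := (h.Tstar_nonneg hM).trans ht.le
    exact ⟨FWSP.mem_intrinsicInterior_stdSimplex (hs.isRelaxation_p.mem_stdSimplex ht0) hpos,
      h.differentiableAt_payoff hpos _⟩
  · obtain ⟨ps, μs, hn⟩ := h.exists_isNash
    refine ⟨ps, μs, hn, fun ε hε =>
      ⟨1 + FWSP.IsBandit.klBound ρ θ b / ε, fun p μ hs t ht => ?_⟩⟩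
    have hC : 0 ≤ FWSP.IsBandit.klBound ρ θ b := FWSP.IsBandit.klBound_nonneg
    have hCε : 0 ≤ FWSP.IsBandit.klBound ρ θ b / ε := by positivity
    refine (hs.abs_payoff_sub_le h hn (by linarith)).trans ?_
    rw [Real.exp_neg, inv_mul_le_iff₀ (Real.exp_pos _)]
    have h1 := Real.add_one_le_exp (t - 1)
    have h2 : FWSP.IsBandit.klBound ρ θ b / ε ≤ Real.exp (t - 1) := by linarith
    rwa [div_le_iff₀ hε] at h2
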